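/- Let $(X,\Phi,X^\vee,\Phi^\vee)$ be a reduced root datum with a base $\Delta$ (for instance the root datum of a split connected reductive group $G$ over $\mathbb{F}_q$ with respect to a split maximal torus $T$, with the simple roots determined by a Borel subgroup $B\supset T$; every reduced root datum with base arises in this way). Let $W$ be its Weyl group ($W=N_G(T)/T$), generated by the set $S$ of reflections in the simple roots, $\ell$ the length function of $(W,S)$ and $\leqslant$ the Bruhat order on $W$. Let $\mathcal{H}$ be the Hecke algebra of $W$, that is, the associative unital algebra over $\mathbb{Z}[t^{1/2},t^{-1/2}]$ generated by elements $T_w$ ($w\in W$) with relations $T_1=1$, $T_wT_{w'}=T_{ww'}$ if $\ell(ww')=\ell(w)+\ell(w')$, and $(T_s+1)(T_s-t)=0$ for $s\in S$. Then: 1. There is a unique family of polynomials $R_{v,w}\in\mathbb{Z}[t]$ ($v,w\in W$, $v\leqslant w$) such that for all $w\in W$ the element $T_{w^{-1}}$ is invertible with $$(T_{w^{-1}})^{-1}=\sum_{v\leqslant w}(-1)^{\ell(w)-\ell(v)}R_{v,w}(t)\,t^{-\ell(w)}\,T_v .$$ 2. There is a unique family of polynomials $P_{v,w}\in\mathbb{Z}[t]$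 ($v,w\in W$, $v\leqslant w$), the Kazhdan–Lusztig polynomials, such that $P_{w,w}=1$ for all $w$, $\deg P_{v,w}\leqslant\frac12(\ell(w)-\ell(v)-1)$ if $v<w$, and $$t^{\ell(w)-\ell(v)}P_{v,w}(t^{-1})=\sum_{v\leqslant y\leqslant w}R_{v,y}(t)P_{y,w}(t)\qquad\text{for all }v\leqslant w.$$ 3. For $d\in\mathbb{Q}$ let $\tau_{\leqslant d}$ be the $\mathbb{Q}$-linear endomorphism of $\mathbb{Q}[t^{1/2},t^{-1/2}]$ given by $\tau_{\leqslant d}\bigl(\sum_{i\in\mathbb{Z}}a_it^{i/2}\bigr)=\sum_{i\leqslant d}a_it^{i/2}$. Then for all $v,w\in W$ with $v<w$, $$P_{v,w}=\tau_{\leqslant\ell(w)-\ell(v)-1}\Bigl(\sum_{v=v_1<\dots<v_r<w}(-1)^r R_{v_1,v_2}\,\tau_{\leqslant\ell(w)-\ell(v_2)}\bigl(R_{v_2,v_3}\cdots\tau_{\leqslant\ell(w)-\ell(v_{r-1})}\bigl(R_{v_{r-1},v_r}\,\tau_{\leqslant\ell(w)-\ell(v_r)}(R_{v_r,w})\bigr)\cdots\bigr)\Bigr),$$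 where the sum runs over all $r\geqslant1$ and all chains $v=v_1<v_2<\dots<v_r<w$ in the Bruhat order, and the term with $r=1$ is $-R_{v,w}$. -/

import Mathlib

open scoped Polynomial LaurentPolynomial

namespace KazhdanLusztig

/-! ### The Weyl group of a root datum -/

/-- An element of the Weyl group moves a character by a combination of roots. -/
theorem weylGroup_smul_sub_mem {ι X Y : Type*} [AddCommGroup X] [AddCommGroup Y]
    (P : RootPairing ι ℤ X Y) (g : P.weylGroup) (x : X) : g • x - x ∈ P.rootSpan ℤ := by
  obtain ⟨g, hg⟩ := g
  induction hg using RootPairing.weylGroup.induction generalizing x with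
  | mem i =>
    have h : (⟨RootPairing.Equiv.reflection P i, P.reflection_mem_weylGroup i⟩ : P.weylGroup) • x
        = P.reflection i x := rfl
    rw [h, RootPairing.reflection_apply, sub_sub_cancel_left, Submodule.neg_mem_iff]
    exact Submodule.smul_mem _ _ (Submodule.subset_span (s := Set.range P.root) ⟨i, rfl⟩)
  | one =>
    have h : (⟨1, one_mem _⟩ : P.weylGroup) • x = x := one_smul P.weylGroup x
    rw [h, sub_self]
    exact Submodule.zero_mem _
  | mul a b ha hb iha ihb =>
    have h : (⟨a * b, mul_mem ha hb⟩ : P.weylGroup) • x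
        = (⟨a, ha⟩ : P.weylGroup) • (⟨b, hb⟩ : P.weylGroup) • x :=
      mul_smul (⟨a, ha⟩ : P.weylGroup) ⟨b, hb⟩ x
    rw [h]
    simpa using Submodule.add_mem _ (iha ((⟨b, hb⟩ : P.weylGroup) • x)) (ihb x)

/-- The Weyl group of a root datum is finite. -/
instance weylGroup_finite {ι X Y : Type*} [Finite ι] [AddCommGroup X] [AddCommGroup Y]
    (P : RootPairing ι ℤ X Y) : Finite P.weylGroup := by
  have := Fintype.ofFinite ι
  refine Finite.of_injective (fun g => P.weylGroupToPerm g)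
    ((injective_iff_map_eq_one P.weylGroupToPerm).2 fun g hg => ?_)
  have hroot : ∀ i, g • P.root i = P.root i := fun i => by
    rw [RootPairing.weylGroup_apply_root, hg]; rfl
  have hspan : ∀ y ∈ P.rootSpan ℤ, g • y = y := fun y hy => by
    induction hy using Submodule.span_induction with
    | mem _ h => obtain ⟨i, rfl⟩ := h; exact hroot i
    | zero => exact smul_zero g
    | add a b _ _ ha hb => rw [smul_add, ha, hb]
    | smul n a _ ha => rw [smul_comm g n a, ha]
  have hx : ∀ x : X, g • x = x := fun x => by
    have hd := weylGroup_smul_sub_mem P g x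
    have h0 : P.RootForm (g • x - x) (g • x - x) = 0 := by
      have h1 : P.RootForm (g • x) (g • (g • x - x)) = P.RootForm x (g • x - x) :=
        RootPairing.InvariantForm.apply_weylGroup_smul P (B := P.toInvariantForm) g x (g • x - x)
      rw [hspan _ hd] at h1
      have h2 := congrArg (fun f => f (g • x - x)) (map_sub P.RootForm (g • x) x)
      simp only [LinearMap.sub_apply] at h2
      rw [h2, h1, sub_self]
    exact sub_eq_zero.1 (P.eq_zero_of_mem_rootSpan_of_rootForm_self_eq_zero hd h0)
  apply Subtype.ext
  apply RootPairing.Equiv.weightHom_injective P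
  ext x
  exact hx x

/-- The simple reflections: the reflections in the simple roots of the base `b`. -/
def simpleReflections {ι X Y : Type*} [AddCommGroup X] [AddCommGroup Y]
    {P : RootPairing ι ℤ X Y} (b : P.Base) : Set P.weylGroup :=
  {s | ∃ i ∈ b.support, s = RootPairing.weylGroup.ofIdx P i}

/-! ### Length and Bruhat order of a group `W` with a set `S` of generators -/

section Group

variable {W : Type*} [Group W] (S : Set W)

/-- The length `ℓ(w)`: the least number of factors in an expression of `w` as a product of
elements of `S` (which is a generating set of involutions in the application). -/
noncomputable def length (w : W) : ℕ :=
  sInf {n | ∃ l : List W, (∀ s ∈ l, s ∈ S) ∧ l.prod = w ∧ l.length = n}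

/-- The reflections: the conjugates of the elements of `S`. -/
def IsReflection (t : W) : Prop := ∃ u : W, ∃ s ∈ S, t = u * s * u⁻¹

/-- The relation generating the Bruhat order: `v = u t` with `t` a reflection and
`ℓ(u) < ℓ(v)`. -/
def BruhatStep (u v : W) : Prop :=
  (∃ t, IsReflection S t ∧ v = u * t) ∧ length S u < length S v

/-- The Bruhat order `v ≤ w`. -/
def BruhatLE (v w : W) : Prop := Relation.ReflTransGen (BruhatStep S) v w

/-- The strict Bruhat order `v < w`. -/
def BruhatLT (v w : W) : Prop := BruhatLE S v w ∧ v ≠ w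

variable {S} in
theorem BruhatLE.eq_or_length_lt {v w : W} (h : BruhatLE S v w) :
    v = w ∨ length S v < length S w := by
  induction h with
  | refl => exact Or.inl rfl
  | tail _ h ih =>
    right
    rcases ih with rfl | ih
    · exact h.2
    · exact ih.trans h.2

variable {S} in
theorem BruhatLT.length_lt {v w : W} (h : BruhatLT S v w) : length S v < length S w :=
  h.1.eq_or_length_lt.resolve_left h.2

variable {S} in
theorem BruhatLT.trans {u v w : W} (h : BruhatLT S u v) (h' : BruhatLT S v w) :
    BruhatLT S u w :=
  ⟨Relation.ReflTransGen.trans h.1 h'.1, by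
    rintro rfl
    exact lt_asymm h.length_lt h'.length_lt⟩

/-- The lower interval `{y | y ≤ w}`. -/
noncomputable def lowerInterval [Finite W] (w : W) : Finset W :=
  (Set.toFinite {y | BruhatLE S y w}).toFinset

/-- The interval `{y | v ≤ y ≤ w}`. -/
noncomputable def interval [Finite W] (v w : W) : Finset W :=
  (Set.toFinite {y | BruhatLE S v y ∧ BruhatLE S y w}).toFinset

/-- There are finitely many chains `v < v₂ < ⋯ < vᵣ < w`. -/
theorem finite_chains [Finite W] (v w : W) :
    {l : List W | List.IsChain (BruhatLT S) (v :: (l ++ [w]))}.Finite := by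
  have := Fintype.ofFinite W
  have ht : IsTrans W (BruhatLT S) := ⟨fun _ _ _ => BruhatLT.trans⟩
  refine (Set.finite_range (Subtype.val : {l : List W // l.Nodup} → List W)).subset ?_
  intro l hl
  have h1 := (List.isChain_iff_pairwise.1 hl)
  have h2 : l.Pairwise (BruhatLT S) :=
    (List.pairwise_append.1 (List.pairwise_cons.1 h1).2).1
  exact ⟨⟨l, h2.imp fun h => h.2⟩, rfl⟩

/-- The chains `v = v₁ < v₂ < ⋯ < vᵣ < w`, `r ≥ 1`, for the strict Bruhat order; such a chain is
recorded by the list `[v₂, …, vᵣ]` (of length `r - 1`). -/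
noncomputable def chains [Finite W] (v w : W) : Finset (List W) :=
  (finite_chains S v w).toFinset

/-! ### The Hecke algebra -/

/-- Defining relations of the Hecke algebra over `ℤ[t^{1/2}, t^{-1/2}]`. The Laurent variable is
`t^{1/2}`, so that `t` is `LaurentPolynomial.T 2`. -/
inductive HeckeRel : FreeAlgebra ℤ[T;T⁻¹] W → FreeAlgebra ℤ[T;T⁻¹] W → Prop
  | one : HeckeRel (FreeAlgebra.ι ℤ[T;T⁻¹] 1) 1
  | mul (w w' : W) (h : length S (w * w') = length S w + length S w') :
      HeckeRel (FreeAlgebra.ι ℤ[T;T⁻¹] w * FreeAlgebra.ι ℤ[T;T⁻¹] w')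
        (FreeAlgebra.ι ℤ[T;T⁻¹] (w * w'))
  | quadratic (s : W) (hs : s ∈ S) :
      HeckeRel
        ((FreeAlgebra.ι ℤ[T;T⁻¹] s + 1) *
          (FreeAlgebra.ι ℤ[T;T⁻¹] s -
            algebraMap ℤ[T;T⁻¹] (FreeAlgebra ℤ[T;T⁻¹] W) (LaurentPolynomial.T 2)))
        0

/-- The Hecke algebra of `(W, S)` over `ℤ[t^{1/2}, t^{-1/2}]`. -/
abbrev HeckeAlgebra : Type _ := RingQuot (HeckeRel S)

/-- The generator `T_w` of the Hecke algebra. -/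
noncomputable def heckeT (w : W) : HeckeAlgebra S :=
  RingQuot.mkAlgHom ℤ[T;T⁻¹] (HeckeRel S) (FreeAlgebra.ι ℤ[T;T⁻¹] w)

/-! ### `R`-polynomials and Kazhdan–Lusztig polynomials -/

/-- The Laurent polynomial `p(t)` in `t^{1/2}` attached to `p ∈ ℤ[t]`, with coefficients in `A`. -/
noncomputable def toHalf (A : Type*) [CommRing A] (p : ℤ[X]) : A[T;T⁻¹] :=
  Polynomial.aeval (LaurentPolynomial.T 2 : A[T;T⁻¹]) p

/-- The Laurent polynomial `p(t⁻¹)` in `t^{1/2}` attached to `p ∈ ℤ[t]`. -/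
noncomputable def toHalfInv (p : ℤ[X]) : ℤ[T;T⁻¹] :=
  Polynomial.aeval (LaurentPolynomial.T (-2) : ℤ[T;T⁻¹]) p

/-- The element `∑_{v ≤ w} (-1)^{ℓ(w) - ℓ(v)} R_{v,w}(t) t^{-ℓ(w)} T_v` of the Hecke algebra. -/
noncomputable def heckeSum [Finite W] (R : W → W → ℤ[X]) (w : W) : HeckeAlgebra S :=
  ∑ v ∈ lowerInterval S w,
    ((-1 : ℤ[T;T⁻¹]) ^ (length S w - length S v) * toHalf ℤ (R v w) *
      LaurentPolynomial.T (-(2 * (length S w : ℤ)))) • heckeT S v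

/-- `R` is the family of `R`-polynomials, extended by `0` to the pairs with `v ≰ w`:
`(T_{w⁻¹})⁻¹ = ∑_{v ≤ w} (-1)^{ℓ(w) - ℓ(v)} R_{v,w}(t) t^{-ℓ(w)} T_v`. -/
structure IsRFamily [Finite W] (R : W → W → ℤ[X]) : Prop where
  eq_zero : ∀ v w, ¬ BruhatLE S v w → R v w = 0
  mul_eq_one : ∀ w, heckeT S w⁻¹ * heckeSum S R w = 1
  eq_one_mul : ∀ w, heckeSum S R w * heckeT S w⁻¹ = 1

/-- The `R`-polynomials of `(W, S)`. -/
noncomputable def rPoly [Finite W] : W → W → ℤ[X] :=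
  Classical.epsilon (IsRFamily S)

/-- `Q` is the family of Kazhdan–Lusztig polynomials, extended by `0` to the pairs with
`v ≰ w`. -/
structure IsKLFamily [Finite W] (Q : W → W → ℤ[X]) : Prop where
  eq_zero : ∀ v w, ¬ BruhatLE S v w → Q v w = 0
  self : ∀ w, Q w w = 1
  natDegree_le : ∀ v w, BruhatLT S v w →
    ((Q v w).natDegree : ℚ) ≤ ((length S w : ℚ) - length S v - 1) / 2
  /-- `t^{ℓ(w) - ℓ(v)} P_{v,w}(t⁻¹) = ∑_{v ≤ y ≤ w} R_{v,y}(t) P_{y,w}(t)`. -/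
  symmetry : ∀ v w, BruhatLE S v w →
    LaurentPolynomial.T (2 * ((length S w : ℤ) - length S v)) * toHalfInv (Q v w) =
      ∑ y ∈ interval S v w, toHalf ℤ (rPoly S v y) * toHalf ℤ (Q y w)

/-- The Kazhdan–Lusztig polynomials of `(W, S)`. -/
noncomputable def klPoly [Finite W] : W → W → ℤ[X] :=
  Classical.epsilon (IsKLFamily S)

/-! ### Truncation and the nested expression -/

/-- The `ℚ`-linear truncation `τ_{≤d} (∑ aᵢ t^{i/2}) = ∑_{i ≤ d} aᵢ t^{i/2}`. -/
noncomputable def trunc (d : ℚ) : ℚ[T;T⁻¹] →ₗ[ℚ] ℚ[T;T⁻¹] where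
  toFun f := AddMonoidAlgebra.ofCoeff (f.coeff.filter fun i : ℤ => (i : ℚ) ≤ d)
  map_add' f g := by
    ext i
    simp [Finsupp.filter_add]
  map_smul' c f := by
    ext i
    simp [Finsupp.filter_smul]

/-- The nested expression attached to the chain `v₁ < v₂ < ⋯ < vᵣ < w`, with first element
`v₁ = u` and tail `[v₂, …, vᵣ]`:
`R_{v₁,v₂} τ_{≤ℓ(w)-ℓ(v₂)}(R_{v₂,v₃} ⋯ τ_{≤ℓ(w)-ℓ(vᵣ)}(R_{vᵣ,w}) ⋯)`. -/
noncomputable def nested [Finite W] (w : W) : W → List W → ℚ[T;T⁻¹]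
  | u, [] => toHalf ℚ (rPoly S u w)
  | u, u' :: l =>
      toHalf ℚ (rPoly S u u') *
        trunc ((length S w : ℚ) - length S u') (nested w u' l)

end Group

end KazhdanLusztig

/-! The Weyl group enters only through strong exchange (`IsCoxeterGroup`). It satisfies this because
its inversion sets, the positive roots made negative by `w`, obey a cocycle rule (`of_inversions`);
reducedness matches reflections with positive roots. Exchange gives the lifting property of the
Bruhat order (`lifting`) and the commutation of left and right multiplication operators on the free
module on `W`. These operators realise the Hecke algebra, so the `T_w` are linearly independent
(`heckeT_sum_injective`).

The `R`-polynomials are then the coordinates of the inverse of `T_{w⁻¹}`. They exist by multiplying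
successively by the inverses of the `T_s`, with lifting controlling the support, and are unique by
linear independence.

The bar map, `t ↦ t⁻¹` on scalars and `T_w ↦ (T_{w⁻¹})⁻¹`, returns each `T_w` to itself when applied
twice, which in coordinates is an inversion formula for `R`. Fix `v < w`, put `l = ℓ(w) - ℓ(v)`, and
suppose `P_{y,w}` known for `v < y ≤ w`. Inversion makes `f = ∑_{v<y≤w} R_{v,y} P_{y,w}` satisfy
`t^l f(t⁻¹) = -f` (`T_mul_toHalfInv_sum`). Minus the part of `f` below degree `l/2` is then a
solution for `P_{v,w}`.

Conversely, the degree bound puts `P_{v,w}` strictly below degree `l/2` and its reversal `t^l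
P_{v,w}(t⁻¹)` strictly above. Truncating the symmetry equation thus isolates `P_{v,w}`
(`kl_eq_trunc`). Unrolling this recursion yields the sum over chains, which involves only `R` and
hence also proves uniqueness. -/

namespace KazhdanLusztig

/-! ### Coxeter groups via strong exchange; the Bruhat order -/

section Coxeter

variable {W : Type*} [Group W] {S : Set W}

/-- Length, reflections and the strong exchange property, as in a Coxeter group. -/
structure IsCoxeterGroup (S : Set W) : Prop where
  closure_eq_top : Subgroup.closure S = ⊤
  mul_self : ∀ s ∈ S, s * s = 1
  length_mul_ne : ∀ w t, IsReflection S t → length S (w * t) ≠ length S w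
  exchange : ∀ l : List W, (∀ s ∈ l, s ∈ S) → ∀ t, IsReflection S t →
    length S (l.prod * t) < length S l.prod → ∃ i < l.length, l.prod * t = (l.eraseIdx i).prod

theorem length_prod_le {l : List W} (hl : ∀ s ∈ l, s ∈ S) : length S l.prod ≤ l.length :=
  Nat.sInf_le ⟨l, hl, rfl, rfl⟩

theorem exists_word (hS : Subgroup.closure S = ⊤) (hinv : ∀ s ∈ S, s * s = 1) (w : W) :
    ∃ l : List W, (∀ s ∈ l, s ∈ S) ∧ l.prod = w := by
  have hw : w ∈ Subgroup.closure S := hS ▸ Subgroup.mem_top w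
  induction hw using Subgroup.closure_induction'' with
  | one => exact ⟨[], by simp⟩
  | mem s hs => exact ⟨[s], by simpa using hs⟩
  | inv_mem s hs => exact ⟨[s], by simpa [eq_inv_iff_mul_eq_one] using ⟨hs, hinv s hs⟩⟩
  | mul x y _ _ hx hy =>
    obtain ⟨l, hl, rfl⟩ := hx
    obtain ⟨m, hm, rfl⟩ := hy
    exact ⟨l ++ m, fun s hs => (List.mem_append.1 hs).elim (hl s) (hm s), by simp⟩

theorem exists_reduced_word (hS : Subgroup.closure S = ⊤) (hinv : ∀ s ∈ S, s * s = 1) (w : W) :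
    ∃ l : List W, (∀ s ∈ l, s ∈ S) ∧ l.prod = w ∧ l.length = length S w := by
  obtain ⟨l, hl, hw⟩ := exists_word hS hinv w
  exact Nat.sInf_mem (s := {n | ∃ l : List W, (∀ s ∈ l, s ∈ S) ∧ l.prod = w ∧ l.length = n})
    ⟨l.length, l, hl, hw, rfl⟩

theorem length_one : length S 1 = 0 :=
  Nat.le_zero.1 (length_prod_le (S := S) (l := []) (by simp))

theorem isReflection_of_mem {s : W} (hs : s ∈ S) : IsReflection S s := ⟨1, s, hs, by simp⟩

theorem IsReflection.conj {t : W} (ht : IsReflection S t) (x : W) :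
    IsReflection S (x * t * x⁻¹) := by
  obtain ⟨u, s, hs, rfl⟩ := ht
  exact ⟨x * u, s, hs, by group⟩

theorem IsReflection.mul_self (hinv : ∀ s ∈ S, s * s = 1) {t : W} (ht : IsReflection S t) :
    t * t = 1 := by
  obtain ⟨u, s, hs, rfl⟩ := ht
  rw [show u * s * u⁻¹ * (u * s * u⁻¹) = u * (s * s) * u⁻¹ by group, hinv s hs]
  group

/-- A family of inversion sets satisfying the cocycle condition yields strong exchange. -/
theorem IsCoxeterGroup.of_inversions (hS : Subgroup.closure S = ⊤) (hinv : ∀ s ∈ S, s * s = 1)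
    (N : W → W → Prop)
    (hsimple : ∀ s ∈ S, ∀ t, IsReflection S t → (N s t ↔ t = s))
    (hmul : ∀ x y t, IsReflection S t → (N (x * y) t ↔ ¬ (N y t ↔ N x (y * t * y⁻¹)))) :
    IsCoxeterGroup S := by
  have hone : ∀ t, IsReflection S t → ¬ N 1 t := fun t ht h => by
    have := hmul 1 1 t ht
    simp_all
  have hex : ∀ l : List W, (∀ s ∈ l, s ∈ S) → ∀ t, IsReflection S t → N l.prod t →
      ∃ i < l.length, l.prod * t = (l.eraseIdx i).prod := by
    intro l
    induction l with
    | nil => intro _ t ht h; exact absurd h (hone t ht)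
    | cons s l ih =>
      intro hl t ht h
      have hs : s ∈ S := hl s (by simp)
      have hl' : ∀ s ∈ l, s ∈ S := fun x hx => hl x (by simp [hx])
      by_cases h' : N l.prod t
      · obtain ⟨i, hi, hit⟩ := ih hl' t ht h'
        exact ⟨i + 1, by simpa using hi, by simp [mul_assoc, hit]⟩
      -- The cocycle rule leaves only an inversion of the first letter, so that letter is the one
      -- deleted.
      · rw [List.prod_cons, hmul _ _ _ ht, hsimple s hs _ (ht.conj _)] at h
        have h2 : l.prod * t * l.prod⁻¹ = s := by tauto
        refine ⟨0, by simp, ?_⟩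
        simp only [List.prod_cons, List.eraseIdx_zero, List.tail_cons]
        rw [← h2]
        have := ht.mul_self hinv
        calc l.prod * t * l.prod⁻¹ * l.prod * t = l.prod * (t * t) := by group
          _ = l.prod := by rw [this, mul_one]
  have hlt : ∀ w t, IsReflection S t → N w t → length S (w * t) < length S w := by
    intro w t ht h
    obtain ⟨l, hl, rfl, hlen⟩ := exists_reduced_word hS hinv w
    obtain ⟨i, hi, hit⟩ := hex l hl t ht h
    rw [hit, ← hlen]
    refine (length_prod_le fun s hs => hl s (List.mem_of_mem_eraseIdx hs)).trans_lt ?_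
    rw [List.length_eraseIdx_of_lt hi]
    omega
  have hself : ∀ t, IsReflection S t → N t t := by
    rintro t ⟨u, s, hs, rfl⟩
    have ht : IsReflection S (u * s * u⁻¹) := ⟨u, s, hs, rfl⟩
    have hs' := isReflection_of_mem hs
    -- Expanding `N` along `u * s * u⁻¹`, the contributions of `u` and `u⁻¹` cancel, because `N 1`
    -- is empty; only `N s s` remains.
    have h1 := hmul (u * s) u⁻¹ _ ht
    have h2 := hmul u s s hs'
    have h3 := hmul u u⁻¹ _ ht
    have h4 := hone _ ht
    have h5 := (hsimple s hs s hs').2 rfl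
    rw [show u⁻¹ * (u * s * u⁻¹) * u⁻¹⁻¹ = s by group] at h1 h3
    rw [show s * s * s⁻¹ = s by group] at h2
    rw [mul_inv_cancel] at h3
    tauto
  have hgt : ∀ w t, IsReflection S t → ¬ N w t → length S w < length S (w * t) := by
    intro w t ht h
    have h1 := hmul w t t ht
    rw [show t * t * t⁻¹ = t by group] at h1
    -- Since `t` inverts itself, exactly one of `w` and `w * t` has `t` as an inversion.
    have := hlt (w * t) t ht (by have := hself t ht; tauto)
    rwa [mul_assoc, ht.mul_self hinv, mul_one] at this
  refine ⟨hS, hinv, fun w t ht => ?_, fun l hl t ht h => hex l hl t ht ?_⟩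
  · by_cases h : N w t
    · exact (hlt w t ht h).ne
    · exact (hgt w t ht h).ne'
  · by_contra h'
    exact lt_asymm h (hgt _ t ht h')

namespace IsCoxeterGroup

variable (hW : IsCoxeterGroup S)
include hW

theorem inv_eq {s : W} (hs : s ∈ S) : s⁻¹ = s :=
  inv_eq_of_mul_eq_one_left (hW.mul_self s hs)

theorem mul_mul_cancel_left {s : W} (hs : s ∈ S) (w : W) : s * (s * w) = w := by
  rw [← mul_assoc, hW.mul_self s hs, one_mul]

theorem mul_mul_cancel_right {s : W} (hs : s ∈ S) (w : W) : w * s * s = w := by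
  rw [mul_assoc, hW.mul_self s hs, mul_one]

theorem length_mul_le (x y : W) : length S (x * y) ≤ length S x + length S y := by
  obtain ⟨l, hl, rfl, h⟩ := exists_reduced_word hW.closure_eq_top hW.mul_self x
  obtain ⟨m, hm, rfl, h'⟩ := exists_reduced_word hW.closure_eq_top hW.mul_self y
  rw [← h, ← h', ← List.length_append, ← List.prod_append]
  exact length_prod_le fun s hs => (List.mem_append.1 hs).elim (hl s) (hm s)

theorem length_inv (w : W) : length S w⁻¹ = length S w := by
  have key : ∀ w, length S w⁻¹ ≤ length S w := fun w => by
    obtain ⟨l, hl, rfl, h⟩ := exists_reduced_word hW.closure_eq_top hW.mul_self w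
    have h1 : l.prod⁻¹ = l.reverse.prod := by
      rw [List.prod_inv_reverse, List.map_congr_left fun s hs => hW.inv_eq (hl s hs),
        List.map_id']
    rw [h1, ← h, ← List.length_reverse]
    exact length_prod_le fun s hs => hl s (List.mem_reverse.1 hs)
  exact (key w).antisymm (by simpa using key w⁻¹)

theorem eq_one_of_length_eq_zero {w : W} (h : length S w = 0) : w = 1 := by
  obtain ⟨l, _, rfl, h'⟩ := exists_reduced_word hW.closure_eq_top hW.mul_self w
  rw [h, List.length_eq_zero_iff] at h'
  simp [h']

theorem length_simple {s : W} (hs : s ∈ S) : length S s = 1 := by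
  refine le_antisymm (by simpa using length_prod_le (S := S) (l := [s]) (by simpa using hs)) ?_
  have := hW.length_mul_ne 1 s (isReflection_of_mem hs)
  rw [one_mul, length_one] at this
  omega

theorem length_mul_simple {s : W} (hs : s ∈ S) (w : W) :
    length S (w * s) = length S w + 1 ∨ length S (w * s) + 1 = length S w := by
  have h1 := hW.length_mul_ne w s (isReflection_of_mem hs)
  have h2 := hW.length_mul_le w s
  have h3 := hW.length_mul_le (w * s) s
  rw [hW.mul_mul_cancel_right hs] at h3
  rw [hW.length_simple hs] at h2 h3
  omega

theorem length_simple_mul {s : W} (hs : s ∈ S) (w : W) :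
    length S (s * w) = length S w + 1 ∨ length S (s * w) + 1 = length S w := by
  have := hW.length_mul_simple hs w⁻¹
  rwa [← hW.length_inv (w⁻¹ * s), mul_inv_rev, inv_inv, hW.inv_eq hs, hW.length_inv w] at this

theorem exists_left_descent {w : W} (h : w ≠ 1) :
    ∃ s ∈ S, length S (s * w) + 1 = length S w := by
  obtain ⟨l, hl, rfl, h'⟩ := exists_reduced_word hW.closure_eq_top hW.mul_self w
  cases l with
  | nil => simp at h
  | cons s l =>
    have hs : s ∈ S := hl s (by simp)
    refine ⟨s, hs, (hW.length_simple_mul hs _).resolve_left fun h2 => ?_⟩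
    rw [← h', List.prod_cons, hW.mul_mul_cancel_left hs] at h2
    have := length_prod_le (S := S) (l := l) fun x hx => hl x (by simp [hx])
    simp at h2
    omega

@[elab_as_elim]
theorem induction_left {p : W → Prop} (one : p 1)
    (mul : ∀ s ∈ S, ∀ w, length S (s * w) = length S w + 1 → p w → p (s * w)) (w : W) : p w := by
  induction hn : length S w generalizing w with
  | zero => rwa [hW.eq_one_of_length_eq_zero hn]
  | succ n ih =>
    obtain ⟨s, hs, h⟩ := hW.exists_left_descent (w := w) (by rintro rfl; simp [length_one] at hn)
    have := mul s hs (s * w) (by rw [hW.mul_mul_cancel_left hs, h]) (ih _ (by omega))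
    rwa [hW.mul_mul_cancel_left hs] at this

/-- Strong exchange for a word starting with the simple reflection `s`. -/
theorem exchange_left {s v t : W} (hs : s ∈ S) (ht : IsReflection S t)
    (hvt : length S (v * t) < length S v) :
    v * t = s * v ∨ length S (s * (v * t)) < length S (s * v) := by
  obtain ⟨l, hl, h, h'⟩ := exists_reduced_word hW.closure_eq_top hW.mul_self (s * v)
  have hv : (s :: l).prod = v := by rw [List.prod_cons, h, hW.mul_mul_cancel_left hs]
  have hl' : ∀ x ∈ s :: l, x ∈ S := List.forall_mem_cons.2 ⟨hs, hl⟩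
  obtain ⟨i, hi, hit⟩ := hW.exchange (s :: l) hl' t ht (by rwa [hv])
  rw [hv] at hit
  cases i with
  | zero => left; rw [hit, ← h]; rfl
  | succ i =>
    right
    rw [hit, List.eraseIdx_cons_succ, List.prod_cons, hW.mul_mul_cancel_left hs, ← h']
    refine (length_prod_le fun x hx => hl x (List.mem_of_mem_eraseIdx hx)).trans_lt ?_
    rw [List.length_cons] at hi
    rw [List.length_eraseIdx_of_lt (by omega)]
    omega

/-- When both multiplications descend, exchange must delete the first letter, since deleting a later
one would shorten `s * w * t` too far. The ascending case reduces to this one at `s * w`. It settles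
the delicate cases of `leftOp_rightOp_comm`. -/
theorem simple_mul_eq_mul_simple {s t w : W} (hs : s ∈ S) (ht : t ∈ S)
    (h1 : length S (s * w * t) = length S w) (h2 : length S (s * w) = length S (w * t)) :
    s * w = w * t := by
  have key : ∀ v, length S (s * v) < length S v → length S (v * t) < length S v →
      length S (s * v * t) = length S v → v * t = s * v := fun v h1 h2 h3 =>
    (hW.exchange_left hs (isReflection_of_mem ht) h2).resolve_right fun h => by
      rw [← mul_assoc] at h; omega
  rcases hW.length_simple_mul hs w with h | h
  · have := key (s * w) (by rw [hW.mul_mul_cancel_left hs]; omega) (by omega)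
      (by rw [hW.mul_mul_cancel_left hs]; omega)
    rw [hW.mul_mul_cancel_left hs] at this
    nth_rewrite 2 [← this]
    rw [hW.mul_mul_cancel_right ht]
  · exact (key w (by omega) (by omega) h1).symm

omit hW in
theorem simple_bruhatLE {s : W} (hs : s ∈ S) {w : W} (h : length S w < length S (s * w)) :
    BruhatLE S w (s * w) := by
  refine Relation.ReflTransGen.single ⟨⟨w⁻¹ * s * w, ?_, by group⟩, h⟩
  simpa using (isReflection_of_mem hs).conj w⁻¹

/-- Left multiplication by a simple reflection and the Bruhat order. -/
theorem simple_mul_le {s : W} (hs : s ∈ S) {v w : W} (h : BruhatLE S v w) :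
    BruhatLE S (s * v) w ∨ BruhatLE S (s * v) (s * w) := by
  induction h using Relation.ReflTransGen.head_induction_on with
  | refl => exact Or.inr .refl
  | @head x y hxy hyw ih =>
    obtain ⟨⟨t, ht, rfl⟩, hlt⟩ := hxy
    have htt := ht.mul_self hW.mul_self
    rcases lt_or_ge (length S (s * x)) (length S (s * (x * t))) with h | h
    · have h' : BruhatLE S (s * x) (s * (x * t)) :=
        Relation.ReflTransGen.single ⟨⟨t, ht, by group⟩, h⟩
      exact ih.imp h'.trans h'.trans
    -- Here `x * t` is longer than `x`, yet `s` does not preserve this order, so exchange forces `s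
    -- * x = x * t`, which lies below `w`.
    · left
      have h0 := hW.length_mul_ne (s * x) t ht
      rw [mul_assoc] at h0
      have h1 := hW.length_simple_mul hs x
      have h2 := hW.length_simple_mul hs (x * t)
      have h3 := hW.exchange_left (v := x * t) hs ht
        (by rwa [mul_assoc, htt, mul_one])
      rw [mul_assoc x, htt, mul_one] at h3
      rw [h3.resolve_right (by omega), hW.mul_mul_cancel_left hs]
      exact hyw

/-- Both alternatives of `simple_mul_le` end below `s * w` once `w` does. This confines the support
of the `R`-polynomials to Bruhat intervals. -/
theorem lifting {s : W} (hs : s ∈ S) {v w : W} (h : BruhatLE S v w)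
    (hw : length S w < length S (s * w)) : BruhatLE S (s * v) (s * w) :=
  (hW.simple_mul_le hs h).elim (fun h' => h'.trans (simple_bruhatLE hs hw)) id

end IsCoxeterGroup

end Coxeter

/-! ### The Weyl group of a reduced root datum has strong exchange -/

section RootDatum

open RootPairing

variable {ι X Y : Type*} [AddCommGroup X] [AddCommGroup Y]
  {P : RootPairing ι ℤ X Y}

theorem weylGroup_ext {g h : P.weylGroup} (H : ∀ x : X, g • x = h • x) : g = h :=
  Subtype.ext (RootPairing.Equiv.weightHom_injective P (by ext x; exact H x))

theorem ofIdx_smul_eq (i : ι) (x : X) : weylGroup.ofIdx P i • x = P.reflection i x := rfl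

theorem ofIdx_mul_self (i : ι) : weylGroup.ofIdx P i * weylGroup.ofIdx P i = 1 :=
  weylGroup_ext fun x => by
    rw [mul_smul, ofIdx_smul_eq, ofIdx_smul_eq, one_smul, P.reflection_same]

theorem weylGroupToPerm_ofIdx (i j : ι) :
    P.weylGroupToPerm (weylGroup.ofIdx P i) j = P.reflectionPerm i j :=
  P.root.injective (by rw [← weylGroup_apply_root, ofIdx_smul_eq, root_reflectionPerm])

theorem conj_ofIdx (g : P.weylGroup) (i : ι) :
    g * weylGroup.ofIdx P i * g⁻¹ = weylGroup.ofIdx P (P.weylGroupToPerm g i) := by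
  have step : ∀ x y : P.weylGroup,
      (∀ i, x * weylGroup.ofIdx P i * x⁻¹ = weylGroup.ofIdx P (P.weylGroupToPerm x i)) →
      (∀ i, y * weylGroup.ofIdx P i * y⁻¹ = weylGroup.ofIdx P (P.weylGroupToPerm y i)) → ∀ i,
      x * y * weylGroup.ofIdx P i * (x * y)⁻¹ =
        weylGroup.ofIdx P (P.weylGroupToPerm (x * y) i) := fun x y hx hy i => by
    rw [map_mul, Equiv.Perm.mul_apply, ← hx, ← hy]
    group
  obtain ⟨g, hg⟩ := g
  induction hg using weylGroup.induction generalizing i with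
  | mem j =>
    refine weylGroup_ext fun x => ?_
    change (weylGroup.ofIdx P j * weylGroup.ofIdx P i * (weylGroup.ofIdx P j)⁻¹) • x =
      weylGroup.ofIdx P (P.weylGroupToPerm (weylGroup.ofIdx P j) i) • x
    rw [weylGroupToPerm_ofIdx, inv_eq_of_mul_eq_one_left (ofIdx_mul_self j), ofIdx_smul_eq,
      reflection_reflectionPerm]
    simp only [mul_smul, ofIdx_smul_eq]
    rfl
  | one =>
    change 1 * weylGroup.ofIdx P i * 1⁻¹ = weylGroup.ofIdx P (P.weylGroupToPerm 1 i)
    simp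
  | mul x y hx hy ihx ihy =>
    exact step ⟨x, hx⟩ ⟨y, hy⟩ ihx ihy i

theorem ofIdx_reflectionPerm_self (i : ι) :
    weylGroup.ofIdx P (P.reflectionPerm i i) = weylGroup.ofIdx P i := by
  rw [← weylGroupToPerm_ofIdx, ← conj_ofIdx, ofIdx_mul_self, one_mul, inv_eq_iff_mul_eq_one,
    ofIdx_mul_self]

theorem weylGroupToPerm_reflectionPerm_self (g : P.weylGroup) (i : ι) :
    P.weylGroupToPerm g (P.reflectionPerm i i) =
      P.reflectionPerm (P.weylGroupToPerm g i) (P.weylGroupToPerm g i) :=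
  P.root.injective (by
    rw [← weylGroup_apply_root, root_reflectionPerm, root_reflectionPerm, reflection_apply_self,
      reflection_apply_self, smul_neg, weylGroup_apply_root])

variable (b : P.Base)

theorem isPos_reflectionPerm_self (i : ι) : b.IsPos (P.reflectionPerm i i) ↔ ¬ b.IsPos i :=
  Base.IsPos.neg_iff_not b i

/-- Conjugating a reflection moves its root, and opposite roots define the same reflection, so the
root may be taken positive. -/
theorem isReflection_simpleReflections {t : P.weylGroup}
    (ht : IsReflection (simpleReflections b) t) : ∃ i, b.IsPos i ∧ t = weylGroup.ofIdx P i := by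
  obtain ⟨u, _, ⟨i, _, rfl⟩, rfl⟩ := ht
  rw [conj_ofIdx]
  by_cases h : b.IsPos (P.weylGroupToPerm u i)
  · exact ⟨_, h, rfl⟩
  · exact ⟨_, (isPos_reflectionPerm_self b _).2 h, (ofIdx_reflectionPerm_self _).symm⟩

variable [P.IsReduced]

/-- Equal reflections give `2 α_i = ⟨α_i, α_j^∨⟩ α_j`; reducedness turns this dependence into `α_i =
± α_j`, and positivity excludes the minus sign. -/
theorem ofIdx_injOn_isPos {i j : ι} (hi : b.IsPos i) (hj : b.IsPos j)
    (h : weylGroup.ofIdx P i = weylGroup.ofIdx P j) : i = j := by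
  have h1 : P.reflection i (P.root i) = P.reflection j (P.root i) := by
    rw [← ofIdx_smul_eq, h, ofIdx_smul_eq]
  rw [reflection_apply_self, reflection_apply_root] at h1
  have h2 : ¬ LinearIndependent ℤ ![P.root i, P.root j] := fun hli => by
    have := LinearIndependent.pair_iff.1 hli 2 (-P.pairing i j) (by
      rw [two_smul, neg_smul, ← sub_eq_add_neg, add_sub_assoc, ← h1, add_neg_cancel])
    omega
  rcases IsReduced.eq_or_eq_neg i j h2 with h3 | h3
  · exact P.root.injective h3
  · rw [show i = P.reflectionPerm j j from P.root.injective (by simpa using h3),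
      isPos_reflectionPerm_self] at hi
    exact absurd hj hi

variable [Finite ι]

theorem closure_simpleReflections : Subgroup.closure (simpleReflections b) = ⊤ := by
  set H := Subgroup.closure (simpleReflections b)
  have key : ∀ i, weylGroup.ofIdx P i ∈ H := fun i => by
    refine b.induction_reflect i (p := fun i => weylGroup.ofIdx P i ∈ H)
      (fun i hi => by rwa [ofIdx_reflectionPerm_self])
      (fun i hi => Subgroup.subset_closure ⟨i, hi, rfl⟩) fun i j hi hj => ?_
    have hj' : weylGroup.ofIdx P j ∈ H := Subgroup.subset_closure ⟨j, hj, rfl⟩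
    rw [← weylGroupToPerm_ofIdx, ← conj_ofIdx]
    exact mul_mem (mul_mem hj' hi) (inv_mem hj')
  refine Subgroup.eq_top_iff' _ |>.2 fun g => ?_
  obtain ⟨g, hg⟩ := g
  induction hg using weylGroup.induction with
  | mem i => exact key i
  | one => exact one_mem H
  | mul x y hx hy ihx ihy => exact mul_mem ihx ihy

/-- The Weyl group of a reduced root datum is a Coxeter group. -/
theorem isCoxeterGroup_weylGroup : IsCoxeterGroup (simpleReflections b) := by
  refine .of_inversions (closure_simpleReflections b) ?_
    -- `t` is an inversion of `w` when `w` makes its positive root negative.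
    (fun w t => ∃ i, b.IsPos i ∧ t = weylGroup.ofIdx P i ∧ ¬ b.IsPos (P.weylGroupToPerm w i)) ?_ ?_
  · rintro _ ⟨i, _, rfl⟩
    exact ofIdx_mul_self i
  · rintro _ ⟨i, hi, rfl⟩ t ht
    constructor
    · rintro ⟨j, hj, rfl, hij⟩
      rw [weylGroupToPerm_ofIdx] at hij
      by_cases h : j = i
      · rw [h]
      -- A simple reflection keeps every positive root other than its own positive.
      · exact absurd (hj.reflectionPerm hi h) hij
    · rintro rfl
      have := b.isPos_of_mem_support hi
      exact ⟨i, this, rfl, by rw [weylGroupToPerm_ofIdx, isPos_reflectionPerm_self]; tauto⟩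
  · intro x y t ht
    obtain ⟨i, hi, rfl⟩ := isReflection_simpleReflections b ht
    have key : ∀ (w : P.weylGroup) (k : ι), b.IsPos k →
        ((∃ j, b.IsPos j ∧ weylGroup.ofIdx P k = weylGroup.ofIdx P j ∧
          ¬ b.IsPos (P.weylGroupToPerm w j)) ↔ ¬ b.IsPos (P.weylGroupToPerm w k)) := by
      refine fun w k hk => ⟨?_, fun h => ⟨k, hk, rfl, h⟩⟩
      rintro ⟨j, hj, hkj, h⟩
      rwa [ofIdx_injOn_isPos b hk hj hkj]
    rw [conj_ofIdx, key _ _ hi, key _ _ hi, map_mul, Equiv.Perm.mul_apply]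
    by_cases h : b.IsPos (P.weylGroupToPerm y i)
    · rw [key _ _ h]
      tauto
    -- If `y` makes the root negative, the positive root of the conjugate reflection is the opposite
    -- one, which flips the sign test for `x`.
    · have h' := (isPos_reflectionPerm_self b _).2 h
      rw [← ofIdx_reflectionPerm_self, key _ _ h', weylGroupToPerm_reflectionPerm_self,
        isPos_reflectionPerm_self]
      tauto

end RootDatum

/-! ### The regular representation and linear independence of the `T_w` -/

section HeckeModule

variable {W : Type*} [Group W] (S : Set W) {A : Type*} [CommRing A] (q : A)

/-- Left multiplication by `T_s` on the free module with basis `W`. -/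
noncomputable def leftOp (s : W) : Module.End A (W →₀ A) :=
  open Classical in
  Finsupp.linearCombination A fun w =>
    if length S w < length S (s * w) then Finsupp.single (s * w) 1
    else (q - 1) • Finsupp.single w 1 + q • Finsupp.single (s * w) 1

/-- Right multiplication by `T_s` on the free module with basis `W`. -/
noncomputable def rightOp (s : W) : Module.End A (W →₀ A) :=
  open Classical in
  Finsupp.linearCombination A fun w =>
    if length S w < length S (w * s) then Finsupp.single (w * s) 1
    else (q - 1) • Finsupp.single w 1 + q • Finsupp.single (w * s) 1

variable {S q}

omit [Group W] in
theorem end_ext {f g : Module.End A (W →₀ A)}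
    (h : ∀ w, f (Finsupp.single w 1) = g (Finsupp.single w 1)) : f = g := by
  ext w : 2
  exact h w

theorem leftOp_of_lt {s w : W} (h : length S w < length S (s * w)) :
    leftOp S q s (Finsupp.single w 1) = Finsupp.single (s * w) 1 := by
  simp [leftOp, h]

theorem leftOp_of_not_lt {s w : W} (h : ¬ length S w < length S (s * w)) :
    leftOp S q s (Finsupp.single w 1) =
      (q - 1) • Finsupp.single w 1 + q • Finsupp.single (s * w) 1 := by
  rw [leftOp, Finsupp.linearCombination_single, one_smul, if_neg h]

theorem rightOp_of_lt {s w : W} (h : length S w < length S (w * s)) :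
    rightOp S q s (Finsupp.single w 1) = Finsupp.single (w * s) 1 := by
  simp [rightOp, h]

theorem rightOp_of_not_lt {s w : W} (h : ¬ length S w < length S (w * s)) :
    rightOp S q s (Finsupp.single w 1) =
      (q - 1) • Finsupp.single w 1 + q • Finsupp.single (w * s) 1 := by
  rw [rightOp, Finsupp.linearCombination_single, one_smul, if_neg h]

namespace IsCoxeterGroup

variable (hW : IsCoxeterGroup S)
include hW

@[elab_as_elim]
theorem induction_right {p : W → Prop} (one : p 1)
    (mul : ∀ s ∈ S, ∀ w, length S (w * s) = length S w + 1 → p w → p (w * s)) (w : W) : p w := by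
  suffices ∀ w, p w⁻¹ by simpa using this w⁻¹
  intro w
  induction w using hW.induction_left with
  | one => simpa
  | mul s hs w h ih =>
    rw [← hW.length_inv (s * w), ← hW.length_inv w, mul_inv_rev, hW.inv_eq hs] at h
    rw [mul_inv_rev, hW.inv_eq hs]
    exact mul s hs _ h ih

theorem leftOp_mul_self {s : W} (hs : s ∈ S) :
    leftOp S q s * leftOp S q s = (q - 1) • leftOp S q s + q • (1 : Module.End A (W →₀ A)) := by
  refine end_ext fun w => ?_
  have h1 := hW.length_simple_mul hs w
  rw [Module.End.mul_apply, LinearMap.add_apply, LinearMap.smul_apply, LinearMap.smul_apply,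
    Module.End.one_apply]
  by_cases h : length S w < length S (s * w)
  · rw [leftOp_of_lt h, leftOp_of_not_lt (by rw [hW.mul_mul_cancel_left hs]; omega),
      hW.mul_mul_cancel_left hs]
  · rw [leftOp_of_not_lt h, map_add, map_smul, map_smul, leftOp_of_not_lt h,
      leftOp_of_lt (by rw [hW.mul_mul_cancel_left hs]; omega), hW.mul_mul_cancel_left hs]

theorem leftOp_quadratic {s : W} (hs : s ∈ S) :
    (leftOp S q s + 1) * (leftOp S q s - algebraMap A (Module.End A (W →₀ A)) q) = 0 := by
  refine LinearMap.ext fun x => ?_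
  have h := LinearMap.congr_fun (hW.leftOp_mul_self (q := q) hs) x
  simp only [Module.End.mul_apply, LinearMap.add_apply, LinearMap.smul_apply,
    Module.End.one_apply] at h
  rw [Module.End.mul_apply, LinearMap.add_apply, LinearMap.sub_apply, Module.algebraMap_end_apply,
    map_sub, map_smul, h, Module.End.one_apply, LinearMap.zero_apply]
  module

/-- In most length patterns the two orders of application agree term by term. In the others `ℓ(s w
t) = ℓ(w)` and `ℓ(s w) = ℓ(w t)`, and exchange gives `s w = w t`. -/
theorem leftOp_rightOp_comm {s t : W} (hs : s ∈ S) (ht : t ∈ S) :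
    Commute (leftOp S q s) (rightOp S q t) := by
  refine end_ext fun w => ?_
  rw [Module.End.mul_apply, Module.End.mul_apply]
  have h1 := hW.length_simple_mul hs w
  have h2 := hW.length_mul_simple ht w
  have h3 := hW.length_simple_mul hs (w * t)
  have h4 := hW.length_mul_simple ht (s * w)
  have h5 := hW.simple_mul_eq_mul_simple (w := w) hs ht
  rw [← mul_assoc] at h3
  by_cases a : length S w < length S (s * w) <;> by_cases b : length S w < length S (w * t)
  · rw [leftOp_of_lt a, rightOp_of_lt b]
    by_cases c : length S (s * w) < length S (s * w * t)
    · rw [rightOp_of_lt c, leftOp_of_lt (by rw [← mul_assoc]; omega), mul_assoc]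
    · rw [rightOp_of_not_lt c, leftOp_of_not_lt (by rw [← mul_assoc]; omega),
        ← mul_assoc s w t, h5 (by omega) (by omega)]
  · rw [leftOp_of_lt a, rightOp_of_not_lt b, map_add, map_smul, map_smul, leftOp_of_lt a,
      leftOp_of_lt (by rw [← mul_assoc]; omega), rightOp_of_not_lt (by omega), mul_assoc s w t]
  · rw [leftOp_of_not_lt a, rightOp_of_lt b, map_add, map_smul, map_smul, rightOp_of_lt b,
      rightOp_of_lt (by omega), leftOp_of_not_lt (by rw [← mul_assoc]; omega), mul_assoc s w t]
  · rw [leftOp_of_not_lt a, rightOp_of_not_lt b, map_add, map_smul, map_smul, map_add, map_smul,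
      map_smul, rightOp_of_not_lt b, leftOp_of_not_lt a]
    by_cases c : length S (s * w) < length S (s * w * t)
    · rw [rightOp_of_lt c, leftOp_of_lt (by rw [← mul_assoc]; omega),
        ← mul_assoc s w t, h5 (by omega) (by omega)]
    · rw [rightOp_of_not_lt c, leftOp_of_not_lt (by rw [← mul_assoc]; omega), mul_assoc s w t]
      module

/-- The right operators carry the basis vector at `1` to every other one along reduced words. This
makes the operator of `T_w` independent of the reduced word used to build it. -/
theorem end_eq_of_apply_one {f g : Module.End A (W →₀ A)}
    (hf : ∀ t ∈ S, Commute f (rightOp S q t)) (hg : ∀ t ∈ S, Commute g (rightOp S q t))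
    (h : f (Finsupp.single 1 1) = g (Finsupp.single 1 1)) : f = g := by
  refine end_ext fun w => ?_
  induction w using hW.induction_right with
  | one => exact h
  | mul t ht w hw ih =>
    rw [← rightOp_of_lt (q := q) (show length S w < length S (w * t) by omega)]
    have h1 := LinearMap.congr_fun (hf t ht).eq (Finsupp.single w 1)
    have h2 := LinearMap.congr_fun (hg t ht).eq (Finsupp.single w 1)
    rw [Module.End.mul_apply, Module.End.mul_apply] at h1 h2
    rw [h1, h2, ih]

theorem exists_end (q : A) (w : W) : ∃ f : Module.End A (W →₀ A),
    (∀ t ∈ S, Commute f (rightOp S q t)) ∧ f (Finsupp.single 1 1) = Finsupp.single w 1 := by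
  induction w using hW.induction_left with
  | one => exact ⟨1, fun t _ => Commute.one_left _, rfl⟩
  | mul s hs w hw ih =>
    obtain ⟨f, hf, hf'⟩ := ih
    refine ⟨leftOp S q s * f, fun t ht => (hW.leftOp_rightOp_comm hs ht).mul_left (hf t ht), ?_⟩
    rw [Module.End.mul_apply, hf', leftOp_of_lt (by omega)]

/-- Left multiplication by `T_w` on the free module with basis `W`. -/
noncomputable def heckeEnd (q : A) (w : W) : Module.End A (W →₀ A) :=
  (hW.exists_end q w).choose

theorem heckeEnd_comm (q : A) (w : W) : ∀ t ∈ S, Commute (hW.heckeEnd q w) (rightOp S q t) :=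
  (hW.exists_end q w).choose_spec.1

theorem heckeEnd_apply_one (q : A) (w : W) :
    hW.heckeEnd q w (Finsupp.single 1 1) = Finsupp.single w 1 :=
  (hW.exists_end q w).choose_spec.2

theorem heckeEnd_one (q : A) : hW.heckeEnd q 1 = 1 :=
  hW.end_eq_of_apply_one (hW.heckeEnd_comm q 1) (fun _ _ => Commute.one_left _)
    (hW.heckeEnd_apply_one q 1)

theorem heckeEnd_simple (q : A) {s : W} (hs : s ∈ S) : hW.heckeEnd q s = leftOp S q s :=
  hW.end_eq_of_apply_one (hW.heckeEnd_comm q s) (fun _ ht => hW.leftOp_rightOp_comm hs ht) (by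
    rw [heckeEnd_apply_one, leftOp_of_lt, mul_one]
    rw [mul_one, length_one, hW.length_simple hs]
    exact one_pos)

theorem heckeEnd_apply (q : A) {w w' : W} (h : length S (w * w') = length S w + length S w') :
    hW.heckeEnd q w (Finsupp.single w' 1) = Finsupp.single (w * w') 1 := by
  induction w using hW.induction_left with
  | one => rw [heckeEnd_one, one_mul]; rfl
  | mul s hs w hw ih =>
    have h1 : hW.heckeEnd q (s * w) = leftOp S q s * hW.heckeEnd q w :=
      hW.end_eq_of_apply_one (hW.heckeEnd_comm q _)
        (fun t ht => (hW.leftOp_rightOp_comm hs ht).mul_left (hW.heckeEnd_comm q w t ht)) (by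
          rw [heckeEnd_apply_one, Module.End.mul_apply, heckeEnd_apply_one,
            leftOp_of_lt (by omega)])
    have h2 := hW.length_simple_mul hs (w * w')
    have h3 := hW.length_mul_le w w'
    rw [mul_assoc] at h ⊢
    rw [h1, Module.End.mul_apply, ih (by omega), leftOp_of_lt (by omega)]

theorem heckeEnd_mul (q : A) {w w' : W} (h : length S (w * w') = length S w + length S w') :
    hW.heckeEnd q w * hW.heckeEnd q w' = hW.heckeEnd q (w * w') :=
  hW.end_eq_of_apply_one
    (fun t ht => (hW.heckeEnd_comm q w t ht).mul_left (hW.heckeEnd_comm q w' t ht))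
    (hW.heckeEnd_comm q _) (by
      rw [Module.End.mul_apply, heckeEnd_apply_one, heckeEnd_apply_one, hW.heckeEnd_apply q h])

/-- The regular representation of the Hecke algebra on the free module with basis `W`. -/
noncomputable def heckeRep : HeckeAlgebra S →ₐ[ℤ[T;T⁻¹]] Module.End ℤ[T;T⁻¹] (W →₀ ℤ[T;T⁻¹]) :=
  RingQuot.liftAlgHom ℤ[T;T⁻¹]
    ⟨FreeAlgebra.lift ℤ[T;T⁻¹] (hW.heckeEnd (LaurentPolynomial.T 2)), fun x y h => by
      induction h with
      | one => rw [FreeAlgebra.lift_ι_apply, heckeEnd_one, map_one]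
      | mul w w' h =>
        rw [map_mul, FreeAlgebra.lift_ι_apply, FreeAlgebra.lift_ι_apply, FreeAlgebra.lift_ι_apply,
          hW.heckeEnd_mul _ h]
      | quadratic s hs =>
        rw [map_mul, map_add, map_sub, map_one, map_zero, AlgHom.commutes,
          FreeAlgebra.lift_ι_apply, hW.heckeEnd_simple _ hs]
        exact hW.leftOp_quadratic hs⟩

theorem heckeRep_heckeT (w : W) :
    hW.heckeRep (heckeT S w) = hW.heckeEnd (LaurentPolynomial.T 2) w := by
  rw [heckeRep, heckeT, RingQuot.liftAlgHom_mkAlgHom_apply, FreeAlgebra.lift_ι_apply]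

theorem heckeRep_sum_apply_one [Fintype W] (c : W → ℤ[T;T⁻¹]) :
    hW.heckeRep (∑ w, c w • heckeT S w) (Finsupp.single 1 1) = Finsupp.equivFunOnFinite.symm c := by
  simp only [map_sum, map_smul, LinearMap.sum_apply, LinearMap.smul_apply, heckeRep_heckeT,
    heckeEnd_apply_one, Finsupp.smul_single, smul_eq_mul, mul_one]
  classical
  ext1 v
  rw [Finset.sum_apply']
  simp [Finsupp.single_apply]

/-- Acting on the basis vector at `1` in the regular representation recovers the coefficients. -/
theorem heckeT_sum_injective [Fintype W] {c d : W → ℤ[T;T⁻¹]}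
    (h : ∑ w, c w • heckeT S w = ∑ w, d w • heckeT S w) : c = d := by
  have := congrArg (fun x => hW.heckeRep x (Finsupp.single 1 1)) h
  simpa only [heckeRep_sum_apply_one, EmbeddingLike.apply_eq_iff_eq] using this

end IsCoxeterGroup

end HeckeModule

/-! ### Polynomials in `t` as Laurent polynomials in `t^{1/2}` -/

section Laurent

variable {A : Type*} [CommRing A]

theorem coeff_T_mul (n i : ℤ) (f : A[T;T⁻¹]) :
    (LaurentPolynomial.T n * f).coeff i = f.coeff (i - n) := by
  have := AddMonoidAlgebra.coeff_single_mul_eq_mul_coeff (x := f) (m := n) (r := 1) (m₁ := i)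
    (i - n) (fun j _ => by constructor <;> intro h <;> omega)
  rwa [one_mul] at this

theorem coeff_toHalf (p : ℤ[X]) (i : ℤ) :
    (toHalf A p).coeff i = if 0 ≤ i ∧ 2 ∣ i then (p.coeff (i / 2).toNat : A) else 0 := by
  induction p using Polynomial.induction_on' with
  | add p q hp hq =>
    rw [toHalf, map_add, AddMonoidAlgebra.coeff_add, Finsupp.add_apply]
    rw [toHalf] at hp hq
    rw [hp, hq, Polynomial.coeff_add]
    split_ifs <;> simp
  | monomial n a =>
    rw [toHalf, Polynomial.aeval_monomial, LaurentPolynomial.T_pow, ← Algebra.smul_def,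
      AddMonoidAlgebra.coeff_smul, Finsupp.smul_apply, LaurentPolynomial.T_apply,
      Polynomial.coeff_monomial]
    split_ifs with h1 h2 h3 h4 h5
    all_goals first | (exfalso; omega) | simp

theorem coeff_toHalf_two_mul (p : ℤ[X]) (n : ℕ) : (toHalf A p).coeff (2 * n) = (p.coeff n : A) := by
  rw [coeff_toHalf, if_pos ⟨by omega, dvd_mul_right _ _⟩]
  simp

theorem toHalf_injective [CharZero A] : Function.Injective (toHalf A) := fun p q h => by
  ext n
  have := congrArg (fun f : A[T;T⁻¹] => f.coeff (2 * n)) h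
  simpa only [coeff_toHalf_two_mul, Int.cast_inj] using this

theorem toHalf_zero : toHalf A 0 = 0 := map_zero _

theorem toHalf_one : toHalf A 1 = 1 := map_one _

theorem toHalfInv_eq (p : ℤ[X]) : toHalfInv p = LaurentPolynomial.invert (toHalf ℤ p) := by
  rw [toHalf, toHalfInv, ← AlgHom.coe_coe, ← Polynomial.aeval_algHom_apply]
  simp

end Laurent

/-! ### Existence and uniqueness of the `R`-polynomials -/

section RPolynomials

variable {W : Type*} [Group W] {S : Set W}

theorem heckeT_one : heckeT S 1 = 1 := by
  rw [heckeT, RingQuot.mkAlgHom_rel _ HeckeRel.one, map_one]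

theorem heckeT_mul {w w' : W} (h : length S (w * w') = length S w + length S w') :
    heckeT S w * heckeT S w' = heckeT S (w * w') := by
  rw [heckeT, heckeT, ← map_mul, RingQuot.mkAlgHom_rel _ (HeckeRel.mul w w' h), heckeT]

theorem mul_self_of_add_one_mul_sub {A B : Type*} [CommRing A] [Ring B] [Algebra A B]
    {a : B} {q : A}
    (h : (a + 1) * (a - algebraMap A B q) = 0) : a * a = (q - 1) • a + q • (1 : B) := by
  rw [add_mul, mul_sub, one_mul, ← Algebra.commutes, ← Algebra.smul_def,
    Algebra.algebraMap_eq_smul_one] at h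
  rw [← sub_eq_zero, ← h]
  module

theorem heckeT_mul_self {s : W} (hs : s ∈ S) : heckeT S s * heckeT S s =
    (LaurentPolynomial.T 2 - 1 : ℤ[T;T⁻¹]) • heckeT S s +
      (LaurentPolynomial.T 2 : ℤ[T;T⁻¹]) • 1 := by
  have h := RingQuot.mkAlgHom_rel ℤ[T;T⁻¹] (HeckeRel.quadratic (S := S) s hs)
  rw [map_mul, map_add, map_sub, map_one, map_zero, AlgHom.commutes, ← heckeT] at h
  exact mul_self_of_add_one_mul_sub (B := HeckeAlgebra S) h

variable (S) in
/-- The inverse of `T_s`. -/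
noncomputable def heckeInv (s : W) : HeckeAlgebra S :=
  (LaurentPolynomial.T (-2) : ℤ[T;T⁻¹]) • (heckeT S s + (1 - LaurentPolynomial.T 2 : ℤ[T;T⁻¹]) • 1)

theorem T_neg_two_smul_T_two_smul (x : HeckeAlgebra S) :
    (LaurentPolynomial.T (-2) : ℤ[T;T⁻¹]) • (LaurentPolynomial.T 2 : ℤ[T;T⁻¹]) • x = x := by
  rw [smul_smul, ← LaurentPolynomial.T_add, neg_add_cancel, LaurentPolynomial.T_zero, one_smul]

theorem heckeInv_mul {s : W} (hs : s ∈ S) : heckeInv S s * heckeT S s = 1 := by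
  rw [heckeInv, smul_mul_assoc, add_mul, heckeT_mul_self hs, smul_mul_assoc, one_mul,
    add_right_comm, ← add_smul, sub_add_sub_cancel, sub_self, zero_smul, zero_add,
    T_neg_two_smul_T_two_smul]

theorem mul_heckeInv {s : W} (hs : s ∈ S) : heckeT S s * heckeInv S s = 1 := by
  rw [heckeInv, mul_smul_comm, mul_add, heckeT_mul_self hs, mul_smul_comm, mul_one, add_right_comm,
    ← add_smul, sub_add_sub_cancel, sub_self, zero_smul, zero_add, T_neg_two_smul_T_two_smul]

/-- The alternating sum `∑ (-1)^{ℓ(v)} r_v(t) T_v`. -/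
noncomputable def altSum (S : Set W) [Fintype W] (r : W → ℤ[X]) : HeckeAlgebra S :=
  ∑ v, ((-1 : ℤ[T;T⁻¹]) ^ length S v * toHalf ℤ (r v)) • heckeT S v

open Classical in
/-- The recursion for the `R`-polynomials under left multiplication by `s`. -/
noncomputable def rStep (S : Set W) (s : W) (r : W → ℤ[X]) (v : W) : ℤ[X] :=
  if length S v < length S (s * v) then
    Polynomial.X * r (s * v) + (Polynomial.X - 1) * r v
  else r (s * v)

namespace IsCoxeterGroup

variable (hW : IsCoxeterGroup S)
include hW

theorem heckeT_simple_mul_of_lt {s w : W} (hs : s ∈ S) (h : length S w < length S (s * w)) :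
    heckeT S s * heckeT S w = heckeT S (s * w) :=
  heckeT_mul (by have := hW.length_simple_mul hs w; rw [hW.length_simple hs]; omega)

theorem heckeInv_mul_of_not_lt {s w : W} (hs : s ∈ S) (h : ¬ length S w < length S (s * w)) :
    heckeInv S s * heckeT S w = heckeT S (s * w) := by
  have h1 := hW.length_simple_mul hs w
  have := hW.heckeT_simple_mul_of_lt hs (w := s * w) (by rw [hW.mul_mul_cancel_left hs]; omega)
  rw [hW.mul_mul_cancel_left hs] at this
  rw [← this, ← mul_assoc, heckeInv_mul hs, one_mul]

theorem heckeInv_mul_of_lt {s w : W} (hs : s ∈ S) (h : length S w < length S (s * w)) :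
    heckeInv S s * heckeT S w = (LaurentPolynomial.T (-2) : ℤ[T;T⁻¹]) • (heckeT S (s * w) +
      (1 - LaurentPolynomial.T 2 : ℤ[T;T⁻¹]) • heckeT S w) := by
  rw [heckeInv, smul_mul_assoc, add_mul, hW.heckeT_simple_mul_of_lt hs h, smul_mul_assoc, one_mul]

theorem neg_one_pow_length_simple_mul {s : W} (hs : s ∈ S) (w : W) :
    (-1 : ℤ[T;T⁻¹]) ^ length S (s * w) = - (-1) ^ length S w := by
  rcases hW.length_simple_mul hs w with h | h
  · rw [h, pow_succ, mul_neg_one]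
  · rw [← h, pow_succ, mul_neg_one, neg_neg]

/-- The recursion in `rStep` comes from multiplying by the inverse of `T_s` and collecting each
`T_v`. The factor `-t` compensates for the changes in `(-1)^{ℓ(w)}` and `t^{-ℓ(w)}` when `ℓ(w)`
grows by one. -/
theorem altSum_rStep [Fintype W] {s : W} (hs : s ∈ S) (r : W → ℤ[X]) :
    altSum S (rStep S s r) =
      (-LaurentPolynomial.T 2 : ℤ[T;T⁻¹]) • (heckeInv S s * altSum S r) := by
  classical
  set ε : W → ℤ[T;T⁻¹] := fun v => (-1 : ℤ[T;T⁻¹]) ^ length S v * toHalf ℤ (r v) with hε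
  let c : W → ℤ[T;T⁻¹] := fun v =>
    if length S v < length S (s * v) then -1 else -LaurentPolynomial.T 2
  let d : W → ℤ[T;T⁻¹] := fun v =>
    if length S v < length S (s * v) then LaurentPolynomial.T 2 - 1 else 0
  have h1 : (-LaurentPolynomial.T 2 : ℤ[T;T⁻¹]) • (heckeInv S s * altSum S r) =
      ∑ v, (ε v * c v) • heckeT S (s * v) + ∑ v, (ε v * d v) • heckeT S v := by
    rw [altSum, Finset.mul_sum, Finset.smul_sum, ← Finset.sum_add_distrib]
    refine Finset.sum_congr rfl fun v _ => ?_
    change _ • (_ * ε v • _) = _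
    rw [mul_smul_comm, smul_comm, mul_smul (ε v), mul_smul (ε v), ← smul_add]
    congr 1
    by_cases h : length S v < length S (s * v)
    · simp only [c, d, if_pos h]
      rw [hW.heckeInv_mul_of_lt hs h, smul_smul, neg_mul, ← LaurentPolynomial.T_add, add_neg_cancel,
        LaurentPolynomial.T_zero, smul_add, smul_smul, neg_one_mul, neg_sub]
    · simp only [c, d, if_neg h]
      rw [hW.heckeInv_mul_of_not_lt hs h, zero_smul, add_zero]
  have h2 : ∑ v, (ε v * c v) • heckeT S (s * v) =
      ∑ v, (ε (s * v) * c (s * v)) • heckeT S v := by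
    rw [← Equiv.sum_comp (Equiv.mulLeft s)]
    simp only [Equiv.coe_mulLeft, hW.mul_mul_cancel_left hs]
  rw [h1, h2, altSum, ← Finset.sum_add_distrib]
  refine Finset.sum_congr rfl fun v _ => ?_
  rw [← add_smul]
  congr 1
  simp only [hε, c, d, rStep, hW.mul_mul_cancel_left hs, hW.neg_one_pow_length_simple_mul hs v]
  have h3 := hW.length_simple_mul hs v
  by_cases h : length S v < length S (s * v)
  · rw [if_pos h, if_pos h, if_neg (by omega)]
    simp only [toHalf, map_add, map_mul, map_sub, map_one, Polynomial.aeval_X]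
    ring
  · rw [if_neg h, if_neg h, if_pos (by omega)]
    ring

theorem heckeT_inv_simple_mul {s w : W} (hs : s ∈ S) (h : length S w < length S (s * w)) :
    heckeT S (s * w)⁻¹ = heckeT S w⁻¹ * heckeT S s := by
  have h1 := hW.length_simple_mul hs w
  rw [mul_inv_rev, hW.inv_eq hs, heckeT_mul]
  rw [← hW.length_inv (w⁻¹ * s), mul_inv_rev, inv_inv, hW.inv_eq hs, hW.length_inv,
    hW.length_simple hs]
  omega

theorem exists_rPolynomials [Fintype W] (w : W) : ∃ r : W → ℤ[X],
    (∀ v, ¬ BruhatLE S v w → r v = 0) ∧ r w = 1 ∧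
    heckeT S w⁻¹ * (((-1 : ℤ[T;T⁻¹]) ^ length S w *
      LaurentPolynomial.T (-(2 * (length S w : ℤ)))) • altSum S r) = 1 ∧
    (((-1 : ℤ[T;T⁻¹]) ^ length S w *
      LaurentPolynomial.T (-(2 * (length S w : ℤ)))) • altSum S r) * heckeT S w⁻¹ = 1 := by
  classical
  induction w using hW.induction_left with
  | one =>
    have h : altSum S (fun v => if v = 1 then 1 else 0) = 1 := by
      rw [altSum, Finset.sum_eq_single 1 (fun v _ hv => by rw [if_neg hv, toHalf_zero, mul_zero,
        zero_smul]) (by simp), if_pos rfl, length_one, toHalf_one, pow_zero, one_mul, one_smul,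
        heckeT_one]
    refine ⟨fun v => if v = 1 then 1 else 0, fun v hv => if_neg ?_, if_pos rfl, ?_, ?_⟩
    · rintro rfl
      exact hv .refl
    all_goals rw [h, length_one, inv_one, heckeT_one]; simp
  | mul s hs w hw ih =>
    obtain ⟨r, hr, hrw, h1, h2⟩ := ih
    have hlt : length S w < length S (s * w) := by omega
    have hle : BruhatLE S w (s * w) := simple_bruhatLE hs hlt
    have hinv := hW.heckeT_inv_simple_mul hs hlt
    have hsum : ((-1 : ℤ[T;T⁻¹]) ^ length S (s * w) *
        LaurentPolynomial.T (-(2 * (length S (s * w) : ℤ)))) • altSum S (rStep S s r) =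
        heckeInv S s * (((-1 : ℤ[T;T⁻¹]) ^ length S w *
          LaurentPolynomial.T (-(2 * (length S w : ℤ)))) • altSum S r) := by
      rw [hW.altSum_rStep hs, hW.neg_one_pow_length_simple_mul hs, mul_smul_comm,
        smul_smul, mul_neg, neg_mul, neg_mul, neg_neg, hw, mul_assoc, ← LaurentPolynomial.T_add]
      congr 3
      push_cast
      ring
    refine ⟨rStep S s r, fun v hv => ?_, ?_, ?_, ?_⟩
    -- If `s * v ≤ w`, lifting would give `v ≤ s * w`.
    · have h3 : r (s * v) = 0 := hr _ fun h => hv <| by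
        have := hW.lifting hs h hlt
        rwa [hW.mul_mul_cancel_left hs] at this
      rw [rStep, h3]
      split_ifs
      · rw [hr v fun h => hv (h.trans hle), mul_zero, mul_zero, add_zero]
      · rfl
    · rw [rStep, hW.mul_mul_cancel_left hs, if_neg (by omega), hrw]
    · rw [hsum, hinv, mul_assoc, ← mul_assoc (heckeT S s), mul_heckeInv hs, one_mul, h1]
    · rw [hsum, hinv, mul_assoc, ← mul_assoc _ (heckeT S w⁻¹), h2, one_mul, heckeInv_mul hs]

end IsCoxeterGroup

/-- Extension by zero lets the sum run over all of `W`, and the sign splits because `ℓ(v) ≤ ℓ(w)` on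
the support. The common factor is a unit, so it can be cancelled later. -/
theorem heckeSum_eq_altSum [Fintype W] {R : W → W → ℤ[X]} {w : W}
    (hR : ∀ v, ¬ BruhatLE S v w → R v w = 0) :
    heckeSum S R w = ((-1 : ℤ[T;T⁻¹]) ^ length S w *
      LaurentPolynomial.T (-(2 * (length S w : ℤ)))) • altSum S fun v => R v w := by
  rw [heckeSum, altSum, Finset.smul_sum]
  refine (Finset.sum_congr rfl fun v hv => ?_).trans
    (Finset.sum_subset (Finset.subset_univ _) fun v _ hv => ?_)
  · have h : BruhatLE S v w := by simpa [lowerInterval] using hv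
    have h' : length S v ≤ length S w := h.eq_or_length_lt.elim (fun h => by rw [h]) le_of_lt
    rw [smul_smul]
    congr 1
    have : (-1 : ℤ[T;T⁻¹]) ^ (length S w - length S v) = (-1) ^ length S w * (-1) ^ length S v := by
      nth_rewrite 2 [← Nat.sub_add_cancel h']
      rw [pow_add, mul_assoc, ← pow_add, Even.neg_one_pow ⟨_, rfl⟩, mul_one]
    rw [this]
    ring
  · have h : ¬ BruhatLE S v w := by simpa [lowerInterval] using hv
    rw [hR v h, toHalf_zero, mul_zero, zero_smul, smul_zero]

namespace IsCoxeterGroup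

variable (hW : IsCoxeterGroup S)
include hW

theorem altSum_injective [Fintype W] : Function.Injective (altSum S) := fun r r' h => by
  have := hW.heckeT_sum_injective h
  funext v
  exact toHalf_injective (((isUnit_one.neg.pow _).mul_right_inj).1 (congrFun this v))

theorem exists_isRFamily [Finite W] : ∃ R, IsRFamily S R ∧ ∀ w, R w w = 1 := by
  have := Fintype.ofFinite W
  choose r h0 h1 h2 h3 using fun w => hW.exists_rPolynomials w
  refine ⟨fun v w => r w v, ⟨fun v w => h0 w v, fun w => ?_, fun w => ?_⟩, h1⟩
  · rw [heckeSum_eq_altSum (h0 w)]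
    exact h2 w
  · rw [heckeSum_eq_altSum (h0 w)]
    exact h3 w

theorem isRFamily_unique [Finite W] {R R' : W → W → ℤ[X]} (hR : IsRFamily S R)
    (hR' : IsRFamily S R') : R = R' := by
  have := Fintype.ofFinite W
  funext v w
  have h : heckeSum S R w = heckeSum S R' w :=
    left_inv_eq_right_inv (hR.eq_one_mul w) (hR'.mul_eq_one w)
  rw [heckeSum_eq_altSum fun v => hR.eq_zero v w, heckeSum_eq_altSum fun v => hR'.eq_zero v w] at h
  have hu : IsUnit ((-1 : ℤ[T;T⁻¹]) ^ length S w *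
      LaurentPolynomial.T (-(2 * (length S w : ℤ)))) :=
    (isUnit_one.neg.pow _).mul (LaurentPolynomial.isUnit_T _)
  exact congrFun (hW.altSum_injective (hu.smul_left_cancel.1 h)) v

theorem existsUnique_isRFamily [Finite W] : ∃! R, IsRFamily S R := by
  obtain ⟨R, hR, _⟩ := hW.exists_isRFamily
  exact ⟨R, hR, fun R' hR' => hW.isRFamily_unique hR' hR⟩

theorem isRFamily_rPoly [Finite W] : IsRFamily S (rPoly S) :=
  Classical.epsilon_spec hW.existsUnique_isRFamily.exists

theorem rPoly_self [Finite W] (w : W) : rPoly S w w = 1 := by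
  obtain ⟨R, hR, h⟩ := hW.exists_isRFamily
  rw [hW.isRFamily_unique hW.isRFamily_rPoly hR, h]

end IsCoxeterGroup

end RPolynomials

/-! ### The bar involution and inversion of the `R`-polynomials -/

section Bar

/-- The inverse of `T_s` obeys the quadratic relation with `t` replaced by `t⁻¹`, which is what
makes the bar map compatible with multiplication by `T_s`. -/
theorem heckeInv_mul_self {W : Type*} [Group W] {S : Set W} {s : W} (hs : s ∈ S) :
    heckeInv S s * heckeInv S s = (LaurentPolynomial.T (-2) - 1 : ℤ[T;T⁻¹]) • heckeInv S s +
      (LaurentPolynomial.T (-2) : ℤ[T;T⁻¹]) • 1 := by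
  nth_rewrite 1 [heckeInv]
  rw [smul_mul_assoc, add_mul, mul_heckeInv hs, smul_mul_assoc, one_mul, smul_add, smul_smul,
    mul_sub, mul_one, ← LaurentPolynomial.T_add, neg_add_cancel, LaurentPolynomial.T_zero, add_comm]

variable {W : Type*} [Group W] {S : Set W} (hW : IsCoxeterGroup S) [Finite W]

namespace IsCoxeterGroup

include hW in
theorem heckeSum_simple_mul {R : W → W → ℤ[X]} (hR : IsRFamily S R) {s w : W} (hs : s ∈ S)
    (h : length S w < length S (s * w)) :
    heckeSum S R (s * w) = heckeInv S s * heckeSum S R w := by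
  refine left_inv_eq_right_inv (hR.eq_one_mul (s * w)) ?_
  rw [hW.heckeT_inv_simple_mul hs h, mul_assoc, ← mul_assoc (heckeT S s), mul_heckeInv hs, one_mul,
    hR.mul_eq_one]

/-- The element `(T_{w⁻¹})⁻¹` in the basis `T_v`. -/
noncomputable def barBasis (w : W) : W →₀ ℤ[T;T⁻¹] :=
  hW.heckeRep (heckeSum S (rPoly S) w) (Finsupp.single 1 1)

theorem barBasis_apply (w v : W) : hW.barBasis w v = ((-1 : ℤ[T;T⁻¹]) ^ length S w *
    LaurentPolynomial.T (-(2 * (length S w : ℤ)))) *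
      ((-1 : ℤ[T;T⁻¹]) ^ length S v * toHalf ℤ (rPoly S v w)) := by
  have := Fintype.ofFinite W
  rw [barBasis, heckeSum_eq_altSum fun v => hW.isRFamily_rPoly.eq_zero v w, map_smul, altSum,
    LinearMap.smul_apply, heckeRep_sum_apply_one, Finsupp.smul_apply, smul_eq_mul]
  rfl

theorem barBasis_one : hW.barBasis 1 = Finsupp.single 1 1 := by
  have h := hW.isRFamily_rPoly.mul_eq_one 1
  rw [inv_one, heckeT_one, one_mul] at h
  rw [barBasis, h, map_one, Module.End.one_apply]

theorem barBasis_simple_mul {s w : W} (hs : s ∈ S) (h : length S w < length S (s * w)) :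
    hW.barBasis (s * w) = hW.heckeRep (heckeInv S s) (hW.barBasis w) := by
  rw [barBasis, hW.heckeSum_simple_mul hW.isRFamily_rPoly hs h, map_mul, Module.End.mul_apply,
    barBasis]

/-- The bar involution in the basis `T_v`. -/
noncomputable def bar : (W →₀ ℤ[T;T⁻¹]) →+ (W →₀ ℤ[T;T⁻¹]) :=
  Finsupp.liftAddHom fun w =>
    ((LinearMap.toSpanSingleton ℤ[T;T⁻¹] _ (hW.barBasis w)).toAddMonoidHom).comp
      (LaurentPolynomial.invert (R := ℤ)).toRingEquiv.toAddEquiv.toAddMonoidHom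

theorem bar_single (w : W) (c : ℤ[T;T⁻¹]) :
    hW.bar (Finsupp.single w c) = LaurentPolynomial.invert c • hW.barBasis w := by
  rw [bar, Finsupp.liftAddHom_apply_single]
  rfl

theorem bar_smul (c : ℤ[T;T⁻¹]) (x : W →₀ ℤ[T;T⁻¹]) :
    hW.bar (c • x) = LaurentPolynomial.invert c • hW.bar x := by
  induction x using Finsupp.induction_linear with
  | zero => simp
  | add x y hx hy => rw [smul_add, map_add, map_add, hx, hy, smul_add]
  | single w d => rw [Finsupp.smul_single, bar_single, bar_single, smul_eq_mul, map_mul, mul_smul]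

omit [Finite W] in
theorem heckeRep_simple {s : W} (hs : s ∈ S) :
    hW.heckeRep (heckeT S s) = leftOp S (LaurentPolynomial.T 2) s := by
  rw [heckeRep_heckeT, hW.heckeEnd_simple _ hs]

omit [Finite W] in
theorem heckeRep_heckeT_heckeInv {s : W} (hs : s ∈ S) (x : W →₀ ℤ[T;T⁻¹]) :
    hW.heckeRep (heckeT S s) (hW.heckeRep (heckeInv S s) x) = x := by
  rw [← Module.End.mul_apply, ← map_mul, mul_heckeInv hs, map_one, Module.End.one_apply]

theorem bar_heckeT_basis {s : W} (hs : s ∈ S) (w : W) :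
    hW.bar (hW.heckeRep (heckeT S s) (Finsupp.single w 1)) =
      hW.heckeRep (heckeInv S s) (hW.barBasis w) := by
  rw [hW.heckeRep_simple hs]
  have h1 := hW.length_simple_mul hs w
  by_cases h : length S w < length S (s * w)
  · rw [leftOp_of_lt h, bar_single, map_one, one_smul, hW.barBasis_simple_mul hs h]
  · have h2 := hW.barBasis_simple_mul (w := s * w) hs (by rw [hW.mul_mul_cancel_left hs]; omega)
    rw [hW.mul_mul_cancel_left hs] at h2
    rw [leftOp_of_not_lt h, map_add, bar_smul, bar_smul, bar_single, bar_single, h2,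
      ← Module.End.mul_apply, ← map_mul, heckeInv_mul_self hs, map_add, map_smul, map_smul, map_one,
      map_one, one_smul, one_smul, map_sub, map_one, LaurentPolynomial.invert_T]
    rfl

theorem bar_heckeT {s : W} (hs : s ∈ S) (x : W →₀ ℤ[T;T⁻¹]) :
    hW.bar (hW.heckeRep (heckeT S s) x) = hW.heckeRep (heckeInv S s) (hW.bar x) := by
  induction x using Finsupp.induction_linear with
  | zero => simp
  | add x y hx hy => rw [map_add, map_add, hx, hy, map_add, map_add]
  | single w c =>
    rw [← mul_one c, ← smul_eq_mul, ← Finsupp.smul_single, map_smul, bar_smul, bar_smul, map_smul,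
      hW.bar_heckeT_basis hs, bar_single, map_one, one_smul]

theorem bar_heckeInv {s : W} (hs : s ∈ S) (x : W →₀ ℤ[T;T⁻¹]) :
    hW.bar (hW.heckeRep (heckeInv S s) x) = hW.heckeRep (heckeT S s) (hW.bar x) := by
  rw [← hW.heckeRep_heckeT_heckeInv hs (hW.bar (hW.heckeRep (heckeInv S s) x)),
    ← hW.bar_heckeT hs, hW.heckeRep_heckeT_heckeInv hs]

/-- The bar map exchanges the actions of `T_s` and its inverse, so it undoes the construction of
`barBasis` letter by letter. -/
theorem bar_barBasis (w : W) : hW.bar (hW.barBasis w) = Finsupp.single w 1 := by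
  induction w using hW.induction_left with
  | one => rw [barBasis_one, bar_single, barBasis_one, map_one, one_smul]
  | mul s hs w h ih =>
    rw [hW.barBasis_simple_mul hs (by omega), hW.bar_heckeInv hs, ih, hW.heckeRep_simple hs,
      leftOp_of_lt (by omega)]

-- This is `bar_barBasis` read at the coordinate `u`; the signs `(-1)^{ℓ(v)}` occur twice and
-- cancel.
include hW in
theorem sum_rPoly_mul_rPoly_inv [Fintype W] [DecidableEq W] (u w : W) :
    ∑ v, toHalf ℤ (rPoly S u v) * (LaurentPolynomial.T (2 * ((length S w : ℤ) - length S v)) *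
      toHalfInv (rPoly S v w)) = if u = w then 1 else 0 := by
  have h := DFunLike.congr_fun (hW.bar_barBasis w) u
  nth_rewrite 1 [← (hW.barBasis w).sum_single] at h
  rw [Finsupp.sum_fintype _ _ (by simp), map_sum, Finset.sum_apply'] at h
  simp only [bar_single, Finsupp.smul_apply, barBasis_apply, smul_eq_mul, map_mul, map_pow, map_neg,
    map_one, LaurentPolynomial.invert_T, ← toHalfInv_eq, neg_neg, Finsupp.single_apply] at h
  have h2 : ∀ v, (-1 : ℤ[T;T⁻¹]) ^ length S v * (-1) ^ length S v = 1 := fun v => by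
    rw [← pow_add, Even.neg_one_pow ⟨_, rfl⟩]
  have h3 : ((-1 : ℤ[T;T⁻¹]) ^ length S w * (-1) ^ length S u) * ∑ v, toHalf ℤ (rPoly S u v) *
      (LaurentPolynomial.T (2 * ((length S w : ℤ) - length S v)) * toHalfInv (rPoly S v w)) =
      if w = u then 1 else 0 := by
    rw [← h, Finset.mul_sum]
    refine Finset.sum_congr rfl fun v _ => ?_
    rw [mul_sub, sub_eq_add_neg, LaurentPolynomial.T_add]
    linear_combination (-1 : ℤ[T;T⁻¹]) ^ length S w * (-1) ^ length S u *
      toHalf ℤ (rPoly S u v) * LaurentPolynomial.T (2 * (length S w : ℤ)) *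
      LaurentPolynomial.T (-(2 * (length S v : ℤ))) * toHalfInv (rPoly S v w) * (-1) *
      (h2 v)
  by_cases huw : u = w
  · subst huw
    rw [h2, one_mul] at h3
    exact h3
  · rw [if_neg (Ne.symm huw)] at h3
    rw [if_neg huw]
    exact (((isUnit_one.neg.pow _).mul (isUnit_one.neg.pow _)).mul_right_eq_zero).1 h3

include hW in
/-- The inversion formula for the `R`-polynomials. -/
theorem sum_rPoly_inv_mul_rPoly [Fintype W] [DecidableEq W] (u w : W) :
    ∑ v, (LaurentPolynomial.T (2 * ((length S v : ℤ) - length S u)) *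
      toHalfInv (rPoly S u v)) * toHalf ℤ (rPoly S v w) = if u = w then 1 else 0 := by
  let M : Matrix W W ℤ[T;T⁻¹] := .of fun u v => toHalf ℤ (rPoly S u v)
  let N : Matrix W W ℤ[T;T⁻¹] := .of fun u v =>
    LaurentPolynomial.T (2 * ((length S v : ℤ) - length S u)) * toHalfInv (rPoly S u v)
  have h : M * N = 1 := by
    ext1 u w
    rw [Matrix.mul_apply, Matrix.one_apply]
    exact hW.sum_rPoly_mul_rPoly_inv u w
  -- For square matrices over a commutative ring a one-sided inverse is two-sided; this puts the
  -- inverted factor on the left.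
  have h1 : N * M = 1 := mul_eq_one_comm.1 h
  have h' := congrFun (congrFun h1 u) w
  rwa [Matrix.mul_apply, Matrix.one_apply] at h'

end IsCoxeterGroup

end Bar

/-! ### Splitting an antisymmetric polynomial at its middle degree -/

section LowerPart

/-- The part of degree less than `l / 2` of a polynomial. -/
noncomputable def lowerPart (l : ℕ) (f : ℤ[X]) : ℤ[X] :=
  ∑ j ∈ Finset.range ((l + 1) / 2), Polynomial.monomial j (f.coeff j)

theorem coeff_lowerPart (l : ℕ) (f : ℤ[X]) (j : ℕ) :
    (lowerPart l f).coeff j = if 2 * j < l then f.coeff j else 0 := by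
  simp only [lowerPart, Polynomial.finsetSum_coeff, Polynomial.coeff_monomial, Finset.sum_ite_eq',
    Finset.mem_range]
  exact if_congr (by omega) rfl rfl

theorem natDegree_lowerPart_lt {l : ℕ} (hl : 0 < l) (f : ℤ[X]) :
    2 * (lowerPart l f).natDegree < l := by
  have : (lowerPart l f).natDegree ≤ (l - 1) / 2 :=
    Polynomial.natDegree_le_iff_coeff_eq_zero.2 fun j hj => by
      rw [coeff_lowerPart, if_neg (by omega)]
  omega

theorem coeff_toHalf_lowerPart (l : ℕ) (f : ℤ[X]) (i : ℤ) :
    (toHalf ℤ (lowerPart l f)).coeff i = if i < l then (toHalf ℤ f).coeff i else 0 := by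
  rw [coeff_toHalf, coeff_toHalf, coeff_lowerPart]
  split_ifs
  all_goals first | (exfalso; omega) | simp

theorem coeff_T_mul_toHalfInv (l : ℤ) (f : ℤ[X]) (i : ℤ) :
    (LaurentPolynomial.T (2 * l) * toHalfInv f).coeff i = (toHalf ℤ f).coeff (2 * l - i) := by
  rw [coeff_T_mul, toHalfInv_eq, LaurentPolynomial.invert_apply, neg_sub]

/-- Antisymmetry makes the reversal of minus the lower part equal to the upper part of `f`. -/
theorem T_mul_toHalfInv_lowerPart {l : ℕ} {f : ℤ[X]}
    (h : LaurentPolynomial.T (2 * (l : ℤ)) * toHalfInv f = -toHalf ℤ f) :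
    LaurentPolynomial.T (2 * (l : ℤ)) * toHalfInv (-lowerPart l f) =
      toHalf ℤ (-lowerPart l f) + toHalf ℤ f := by
  have h' : ∀ i, (toHalf ℤ f).coeff (2 * l - i) = -(toHalf ℤ f).coeff i := fun i => by
    rw [← coeff_T_mul_toHalfInv, h]
    rfl
  ext i
  have hneg : toHalf ℤ (-lowerPart l f) = -toHalf ℤ (lowerPart l f) := map_neg _ _
  rw [coeff_T_mul_toHalfInv, hneg, AddMonoidAlgebra.coeff_add, Finsupp.add_apply]
  change -(toHalf ℤ (lowerPart l f)).coeff _ = -(toHalf ℤ (lowerPart l f)).coeff _ + _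
  rw [coeff_toHalf_lowerPart, coeff_toHalf_lowerPart]
  have := h' i
  rcases lt_trichotomy i l with hi | rfl | hi
  · rw [if_neg (by omega), if_pos hi]
    ring
  -- The middle coefficient equals its own negative, hence vanishes.
  · rw [show 2 * (l : ℤ) - l = l by ring] at this ⊢
    simp only [lt_self_iff_false, if_false]
    omega
  · rw [if_pos (by omega), if_neg (by omega), this]
    ring

end LowerPart

/-! ### Existence of the Kazhdan–Lusztig polynomials -/

section KL

variable {W : Type*} [Group W] {S : Set W} [Finite W]

theorem mem_interval {v w y : W} : y ∈ interval S v w ↔ BruhatLE S v y ∧ BruhatLE S y w := by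
  simp [interval]

theorem mem_chains {v w : W} {l : List W} :
    l ∈ chains S v w ↔ List.IsChain (BruhatLT S) (v :: (l ++ [w])) := by
  simp [chains]

omit [Finite W] in
theorem BruhatLE.length_le {v w : W} (h : BruhatLE S v w) : length S v ≤ length S w :=
  h.eq_or_length_lt.elim (fun h => by rw [h]) le_of_lt

open Classical in
/-- The Kazhdan–Lusztig polynomials, constructed by downward induction on `v`. -/
noncomputable def klAux (S : Set W) (w v : W) : ℤ[X] :=
  if v = w then 1
  else if BruhatLE S v w then
    -lowerPart (length S w - length S v)
      (∑ y ∈ ((interval S v w).erase v).attach, rPoly S v y.1 * klAux S w y.1)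
  else 0
termination_by length S w - length S v
decreasing_by
  obtain ⟨hy, hy'⟩ := Finset.mem_erase.1 y.2
  have h := mem_interval.1 hy'
  have h1 := h.1.eq_or_length_lt.resolve_left hy.symm
  have h2 := h.2.length_le
  omega

theorem klAux_self (w : W) : klAux S w w = 1 := by
  rw [klAux, if_pos rfl]

theorem klAux_of_not_le {v w : W} (h : ¬ BruhatLE S v w) : klAux S w v = 0 := by
  rw [klAux, if_neg (by rintro rfl; exact h .refl), if_neg h]

theorem klAux_of_lt [DecidableEq W] {v w : W} (h : BruhatLT S v w) :
    klAux S w v = -lowerPart (length S w - length S v)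
      (∑ y ∈ (interval S v w).erase v, rPoly S v y * klAux S w y) := by
  rw [klAux, if_neg h.2, if_pos h.1,
    ← Finset.sum_attach (Finset.erase _ _) fun y => rPoly S v y * klAux S w y]
  congr!

namespace IsCoxeterGroup

variable (hW : IsCoxeterGroup S)
include hW

theorem sum_interval_rPoly_mul [Fintype W] {p : W → ℤ[X]} (v w : W)
    (hp : ∀ y, ¬ BruhatLE S y w → p y = 0) :
    ∑ y ∈ interval S v w, toHalf ℤ (rPoly S v y) * toHalf ℤ (p y) =
      ∑ y, toHalf ℤ (rPoly S v y) * toHalf ℤ (p y) := by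
  refine Finset.sum_subset (Finset.subset_univ _) fun y _ hy => ?_
  rw [mem_interval, not_and_or] at hy
  rcases hy with hy | hy
  · rw [hW.isRFamily_rPoly.eq_zero _ _ hy, toHalf_zero, zero_mul]
  · rw [hp y hy, toHalf_zero, mul_zero]

/-- Let `F y = ∑ R_{y,z} p_z`. By the symmetry above `v`, the reversed sum is the full pairing of
the reversed `R_{v,y}` with `F y`, less its term at `v`. Inversion evaluates that pairing as `p v`,
so the result is `p v - F v`, the negative of the original sum. No symmetry at `v` is needed. -/
theorem T_mul_toHalfInv_sum [Fintype W] [DecidableEq W] {p : W → ℤ[X]} {v w : W}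
    (hp : ∀ y, ¬ BruhatLE S y w → p y = 0)
    (h : ∀ y, BruhatLT S v y → BruhatLE S y w →
      LaurentPolynomial.T (2 * ((length S w : ℤ) - length S y)) * toHalfInv (p y) =
        ∑ z ∈ interval S y w, toHalf ℤ (rPoly S y z) * toHalf ℤ (p z)) :
    LaurentPolynomial.T (2 * ((length S w : ℤ) - length S v)) *
      toHalfInv (∑ y ∈ (interval S v w).erase v, rPoly S v y * p y) =
        -toHalf ℤ (∑ y ∈ (interval S v w).erase v, rPoly S v y * p y) := by
  let Rv : W → ℤ[T;T⁻¹] := fun y =>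
    LaurentPolynomial.T (2 * ((length S y : ℤ) - length S v)) * toHalfInv (rPoly S v y)
  let F : W → ℤ[T;T⁻¹] := fun y => ∑ z, toHalf ℤ (rPoly S y z) * toHalf ℤ (p z)
  have hRv : ∀ y, ¬ BruhatLE S v y → Rv y = 0 := fun y hy => by
    simp only [Rv]
    rw [hW.isRFamily_rPoly.eq_zero _ _ hy, toHalfInv, map_zero, mul_zero]
  have hRvv : Rv v = 1 := by
    simp only [Rv]
    rw [hW.rPoly_self, sub_self, mul_zero, LaurentPolynomial.T_zero, toHalfInv, map_one, one_mul]
  have hF : ∀ y, ¬ BruhatLE S y w → F y = 0 := fun y hy =>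
    Finset.sum_eq_zero fun z _ => by
      by_cases hz : BruhatLE S y z
      · rw [hp z fun hz' => hy (hz.trans hz'), toHalf_zero, mul_zero]
      · rw [hW.isRFamily_rPoly.eq_zero _ _ hz, toHalf_zero, zero_mul]
  have h1 : LaurentPolynomial.T (2 * ((length S w : ℤ) - length S v)) *
      toHalfInv (∑ y ∈ (interval S v w).erase v, rPoly S v y * p y) =
        ∑ y ∈ Finset.univ.erase v, Rv y * F y := by
    rw [toHalfInv, map_sum, Finset.mul_sum]
    refine (Finset.sum_congr rfl fun y hy => ?_).trans
      (Finset.sum_subset (Finset.erase_subset_erase _ (Finset.subset_univ _)) fun y hy hy' => ?_)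
    · obtain ⟨hyv, hy⟩ := Finset.mem_erase.1 hy
      obtain ⟨hvy, hyw⟩ := mem_interval.1 hy
      simp only [F]
      rw [← hW.sum_interval_rPoly_mul y w hp, ← h y ⟨hvy, hyv.symm⟩ hyw, map_mul,
        show 2 * ((length S w : ℤ) - length S v) =
          2 * ((length S y : ℤ) - length S v) + 2 * ((length S w : ℤ) - length S y) by ring,
        LaurentPolynomial.T_add]
      simp only [Rv, toHalfInv]
      ring
    · rw [Finset.mem_erase, mem_interval] at hy'
      by_cases hvy : BruhatLE S v y
      · rw [hF y fun hyw => hy' ⟨Finset.ne_of_mem_erase hy, hvy, hyw⟩, mul_zero]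
      · rw [hRv y hvy, zero_mul]
  have h2 : ∑ y, Rv y * F y = toHalf ℤ (p v) := by
    simp only [F, Finset.mul_sum]
    rw [Finset.sum_comm]
    simp only [← mul_assoc, ← Finset.sum_mul]
    simp only [Rv, hW.sum_rPoly_inv_mul_rPoly, ite_mul, one_mul, zero_mul, Finset.sum_ite_eq,
      Finset.mem_univ, if_true]
  have h3 : toHalf ℤ (∑ y ∈ (interval S v w).erase v, rPoly S v y * p y) =
      F v - toHalf ℤ (p v) := by
    rw [toHalf, map_sum]
    simp only [F]
    rw [← hW.sum_interval_rPoly_mul v w hp]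
    by_cases hvw : v ∈ interval S v w
    · rw [← Finset.add_sum_erase _ _ hvw, hW.rPoly_self, toHalf_one, one_mul, add_sub_cancel_left]
      simp only [map_mul, toHalf]
    · rw [Finset.erase_eq_of_notMem hvw, hp v fun h => hvw (mem_interval.2 ⟨.refl, h⟩), toHalf_zero,
        sub_zero]
      simp only [map_mul, toHalf]
  have h4 := Finset.add_sum_erase Finset.univ (fun y => Rv y * F y) (Finset.mem_univ v)
  rw [h1, h3]
  simp only [h2, hRvv, one_mul] at h4
  linear_combination h4

theorem klAux_symmetry {v w : W} (h : BruhatLE S v w) :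
    LaurentPolynomial.T (2 * ((length S w : ℤ) - length S v)) * toHalfInv (klAux S w v) =
      ∑ y ∈ interval S v w, toHalf ℤ (rPoly S v y) * toHalf ℤ (klAux S w y) := by
  classical
  have := Fintype.ofFinite W
  induction hn : length S w - length S v using Nat.strong_induction_on generalizing v with
  | _ n ih =>
  have hv : v ∈ interval S v w := mem_interval.2 ⟨.refl, h⟩
  rw [← Finset.add_sum_erase _ _ hv, hW.rPoly_self, toHalf_one, one_mul]
  rcases eq_or_ne v w with rfl | hvw
  · have : (interval S v v).erase v = ∅ := by
      refine Finset.eq_empty_of_forall_notMem fun y hy => ?_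
      obtain ⟨hyv, hy⟩ := Finset.mem_erase.1 hy
      obtain ⟨h1, h2⟩ := mem_interval.1 hy
      have := h1.eq_or_length_lt.resolve_left hyv.symm
      have := h2.length_le
      omega
    rw [this, Finset.sum_empty, klAux_self, sub_self, mul_zero, LaurentPolynomial.T_zero, toHalfInv,
      map_one, toHalf_one, mul_one, add_zero]
  · have hlt : BruhatLT S v w := ⟨h, hvw⟩
    have key := hW.T_mul_toHalfInv_sum (p := klAux S w) (v := v) (w := w)
      (fun y hy => klAux_of_not_le hy) fun y hvy hyw => by
        have h1 := hvy.length_lt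
        have h2 := hyw.length_le
        exact ih (length S w - length S y) (by omega) hyw rfl
    have hl : (length S w : ℤ) - length S v = (length S w - length S v : ℕ) := by
      have := h.length_le
      omega
    rw [hl] at key ⊢
    rw [klAux_of_lt hlt, T_mul_toHalfInv_lowerPart key]
    congr 1
    rw [toHalf, map_sum]
    simp only [map_mul, toHalf]

theorem exists_isKLFamily : ∃ Q, IsKLFamily S Q := by
  classical
  refine ⟨fun v w => klAux S w v, fun v w h => klAux_of_not_le h, klAux_self, fun v w h => ?_,
    fun v w h => hW.klAux_symmetry h⟩
  have hl := h.length_lt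
  rw [klAux_of_lt h, Polynomial.natDegree_neg, le_div_iff₀ two_pos, le_sub_iff_add_le,
    le_sub_iff_add_le]
  have := natDegree_lowerPart_lt (l := length S w - length S v) (by omega)
    (∑ y ∈ (interval S v w).erase v, rPoly S v y * klAux S w y)
  have h' : (lowerPart (length S w - length S v)
    (∑ y ∈ (interval S v w).erase v, rPoly S v y * klAux S w y)).natDegree * 2 + 1 + length S v ≤
      length S w := by omega
  exact_mod_cast h'

end IsCoxeterGroup

end KL

/-! ### The chain formula and uniqueness -/

section Chains

variable {W : Type*} [Group W] {S : Set W} [Finite W]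

theorem coeff_trunc (d : ℚ) (f : ℚ[T;T⁻¹]) (i : ℤ) :
    (trunc d f).coeff i = if (i : ℚ) ≤ d then f.coeff i else 0 :=
  Finsupp.filter_apply _ _ _

variable (S) in
/-- The open interval `{y | v < y < w}`. -/
noncomputable def openInterval (v w : W) : Finset W :=
  open Classical in ((interval S v w).erase v).erase w

theorem mem_openInterval {v w y : W} :
    y ∈ openInterval S v w ↔ BruhatLT S v y ∧ BruhatLT S y w := by
  simp only [openInterval, Finset.mem_erase, mem_interval, BruhatLT]
  tauto

omit [Finite W] in
theorem BruhatLT.of_isChain {v w : W} {l : List W}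
    (h : List.IsChain (BruhatLT S) (v :: (l ++ [w]))) : BruhatLT S v w := by
  have ht : IsTrans W (BruhatLT S) := ⟨fun _ _ _ => BruhatLT.trans⟩
  exact (List.pairwise_cons.1 (List.isChain_iff_pairwise.1 h)).1 w (by simp)

theorem chains_eq [DecidableEq W] {v w : W} (h : BruhatLT S v w) :
    chains S v w = insert [] ((openInterval S v w).biUnion fun y =>
      (chains S y w).image (List.cons y)) := by
  ext l
  cases l with
  | nil => simpa [mem_chains] using h
  | cons y l =>
    simp only [mem_chains, List.cons_append, List.isChain_cons_cons, Finset.mem_insert,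
      reduceCtorEq, false_or, Finset.mem_biUnion, Finset.mem_image, List.cons.injEq,
      mem_openInterval]
    constructor
    · rintro ⟨h1, h2⟩
      exact ⟨y, ⟨h1, .of_isChain h2⟩, l, h2, rfl, rfl⟩
    · rintro ⟨_, ⟨h1, _⟩, _, h2, rfl, rfl⟩
      exact ⟨h1, h2⟩

/-- A chain either has no vertex between `v` and `w` or is determined by its second vertex `y` and a
chain from `y` to `w`. -/
theorem sum_chains {M : Type*} [AddCommMonoid M] {v w : W} (h : BruhatLT S v w)
    (f : List W → M) :
    ∑ l ∈ chains S v w, f l =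
      f [] + ∑ y ∈ openInterval S v w, ∑ l ∈ chains S y w, f (y :: l) := by
  classical
  rw [chains_eq h, Finset.sum_insert (by simp), Finset.sum_biUnion]
  · refine congrArg _ (Finset.sum_congr rfl fun y _ => ?_)
    exact Finset.sum_image fun a _ b _ hab => (List.cons.inj hab).2
  · intro y _ z _ hyz
    refine Finset.disjoint_left.2 fun l hl hl' => hyz ?_
    obtain ⟨a, _, rfl⟩ := Finset.mem_image.1 hl
    obtain ⟨b, _, hb⟩ := Finset.mem_image.1 hl'
    exact (List.cons.inj hb).1.symm

variable (S) in
/-- The alternating sum over chains of the nested expressions. -/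
noncomputable def chainSum (v w : W) : ℚ[T;T⁻¹] :=
  ∑ l ∈ chains S v w, (-1) ^ (l.length + 1) * nested S w v l

theorem chainSum_eq {v w : W} (h : BruhatLT S v w) :
    chainSum S v w = -(toHalf ℚ (rPoly S v w) + ∑ y ∈ openInterval S v w,
      toHalf ℚ (rPoly S v y) * trunc ((length S w : ℚ) - length S y) (chainSum S y w)) := by
  rw [chainSum, sum_chains h, neg_add, ← Finset.sum_neg_distrib]
  congr 1
  · simp [nested]
  · refine Finset.sum_congr rfl fun y _ => ?_
    rw [chainSum, map_sum, Finset.mul_sum, ← Finset.sum_neg_distrib]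
    refine Finset.sum_congr rfl fun l _ => ?_
    -- As a rational scalar, the sign passes through the linear truncation; prepending `v` then
    -- flips it.
    have hs : (-1 : ℚ[T;T⁻¹]) ^ (l.length + 1) * nested S w y l =
        ((-1 : ℚ) ^ (l.length + 1)) • nested S w y l := by
      rw [Algebra.smul_def, map_pow, map_neg, map_one]
    rw [hs, map_smul, nested, Algebra.smul_def, map_pow, map_neg, map_one, List.length_cons]
    ring

theorem IsKLFamily.coeff_eq_zero {Q : W → W → ℤ[X]} (hQ : IsKLFamily S Q) {v w : W}
    (h : BruhatLT S v w) {i : ℤ} (hi : (length S w : ℤ) - length S v ≤ i) :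
    (toHalf ℚ (Q v w)).coeff i = 0 := by
  have h1 := hQ.natDegree_le v w h
  rw [le_div_iff₀ two_pos, le_sub_iff_add_le, le_sub_iff_add_le] at h1
  have h2 : (Q v w).natDegree * 2 + 1 + length S v ≤ length S w := by exact_mod_cast h1
  rw [coeff_toHalf]
  split_ifs
  · rw [Polynomial.coeff_eq_zero_of_natDegree_lt (by omega), Int.cast_zero]
  · rfl

namespace IsCoxeterGroup

variable (hW : IsCoxeterGroup S)
include hW

theorem sum_interval_kl {Q : W → W → ℤ[X]} (hQ : IsKLFamily S Q) {v w : W}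
    (h : BruhatLT S v w) :
    ∑ y ∈ interval S v w, toHalf ℚ (rPoly S v y) * toHalf ℚ (Q y w) =
      toHalf ℚ (Q v w) + (toHalf ℚ (rPoly S v w) +
        ∑ y ∈ openInterval S v w, toHalf ℚ (rPoly S v y) * toHalf ℚ (Q y w)) := by
  classical
  have hv : v ∈ interval S v w := mem_interval.2 ⟨.refl, h.1⟩
  have hw : w ∈ (interval S v w).erase v :=
    Finset.mem_erase.2 ⟨h.2.symm, mem_interval.2 ⟨h.1, .refl⟩⟩
  have ho : openInterval S v w = ((interval S v w).erase v).erase w := rfl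
  rw [← Finset.add_sum_erase _ _ hv, ← Finset.add_sum_erase _ _ hw, hW.rPoly_self, toHalf_one,
    one_mul, hQ.self, toHalf_one, mul_one, ho]

omit hW in
theorem kl_coeff_symm {Q : W → W → ℤ[X]} (hQ : IsKLFamily S Q) {v w : W}
    (h : BruhatLT S v w) (i : ℤ) :
    (toHalf ℚ (Q v w)).coeff (2 * ((length S w : ℤ) - length S v) - i) =
      (∑ y ∈ interval S v w, toHalf ℚ (rPoly S v y) * toHalf ℚ (Q y w)).coeff i := by
  have hcast : ∀ (p : ℤ[X]) (j : ℤ), (toHalf ℚ p).coeff j = ((toHalf ℤ p).coeff j : ℚ) :=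
    fun p j => by rw [coeff_toHalf, coeff_toHalf]; split_ifs <;> simp
  have hsum : ∀ (A : Type) [CommRing A],
      ∑ y ∈ interval S v w, toHalf A (rPoly S v y) * toHalf A (Q y w) =
        toHalf A (∑ y ∈ interval S v w, rPoly S v y * Q y w) := fun A _ => by
    simp only [toHalf, map_sum, map_mul]
  rw [hsum, hcast, hcast, ← coeff_T_mul_toHalfInv, hQ.symmetry v w h.1, hsum]

/-- With `l = ℓ(w) - ℓ(v)`, `Q v w` lives in exponents of `t^{1/2}` at most `l - 1` and its reversal
in those at least `l + 1`. Any cutoff in `[l - 1, l]` separates them. -/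
theorem kl_eq_trunc {Q : W → W → ℤ[X]} (hQ : IsKLFamily S Q) {v w : W}
    (h : BruhatLT S v w) {d : ℚ} (h1 : (length S w : ℚ) - length S v - 1 ≤ d)
    (h2 : d ≤ (length S w : ℚ) - length S v) :
    toHalf ℚ (Q v w) = trunc d (-(toHalf ℚ (rPoly S v w) +
      ∑ y ∈ openInterval S v w, toHalf ℚ (rPoly S v y) * toHalf ℚ (Q y w))) := by
  ext i
  have h3 := kl_coeff_symm hQ h i
  rw [hW.sum_interval_kl hQ h, AddMonoidAlgebra.coeff_add, Finsupp.add_apply] at h3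
  rw [coeff_trunc]
  split_ifs with hi
  · have h4 : i ≤ (length S w : ℤ) - length S v := by exact_mod_cast hi.trans h2
    rw [hQ.coeff_eq_zero h (by omega)] at h3
    exact eq_neg_of_add_eq_zero_left h3.symm
  · refine hQ.coeff_eq_zero h ?_
    have h4 : (length S w : ℤ) - length S v - 1 < i := by exact_mod_cast h1.trans_lt (not_le.1 hi)
    omega

theorem kl_eq_trunc_chainSum {Q : W → W → ℤ[X]} (hQ : IsKLFamily S Q) {v w : W}
    (h : BruhatLT S v w) {d : ℚ} (h1 : (length S w : ℚ) - length S v - 1 ≤ d)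
    (h2 : d ≤ (length S w : ℚ) - length S v) :
    toHalf ℚ (Q v w) = trunc d (chainSum S v w) := by
  induction hn : length S w - length S v using Nat.strong_induction_on generalizing v d with
  | _ n ih =>
  rw [hW.kl_eq_trunc hQ h h1 h2, chainSum_eq h]
  congr 3
  refine Finset.sum_congr rfl fun y hy => ?_
  obtain ⟨hvy, hyw⟩ := mem_openInterval.1 hy
  have h3 := hvy.length_lt
  have h4 := hyw.length_lt
  -- Inner truncations use the largest admissible cutoff and the outer one in the theorem the
  -- smallest, hence the induction over varying `d`.
  rw [ih (length S w - length S y) (by omega) hyw (by linarith) le_rfl rfl]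

/-- The chain sum depends on the `R`-polynomials alone, so it determines every off-diagonal entry of
the family. -/
theorem isKLFamily_unique {Q Q' : W → W → ℤ[X]} (hQ : IsKLFamily S Q)
    (hQ' : IsKLFamily S Q') : Q = Q' := by
  funext v w
  by_cases hle : BruhatLE S v w
  · rcases eq_or_ne v w with rfl | hne
    · rw [hQ.self, hQ'.self]
    · have h : BruhatLT S v w := ⟨hle, hne⟩
      refine toHalf_injective (A := ℚ) ?_
      rw [hW.kl_eq_trunc_chainSum hQ h le_rfl (by linarith),
        hW.kl_eq_trunc_chainSum hQ' h le_rfl (by linarith)]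
  · rw [hQ.eq_zero v w hle, hQ'.eq_zero v w hle]

theorem existsUnique_isKLFamily : ∃! Q, IsKLFamily S Q := by
  obtain ⟨Q, hQ⟩ := hW.exists_isKLFamily
  exact ⟨Q, hQ, fun Q' hQ' => hW.isKLFamily_unique hQ' hQ⟩

theorem isKLFamily_klPoly : IsKLFamily S (klPoly S) :=
  Classical.epsilon_spec hW.existsUnique_isKLFamily.exists

end IsCoxeterGroup

end Chains

end KazhdanLusztig

theorem mainTheorem1 {ι X Y : Type*} [Finite ι] [AddCommGroup X] [AddCommGroup Y]
    [Module.Free ℤ X] [Module.Finite ℤ X] [Module.Free ℤ Y] [Module.Finite ℤ Y]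
    (P : RootDatum ι X Y) [P.IsReduced] (b : P.Base) :
    (∃! R, KazhdanLusztig.IsRFamily (KazhdanLusztig.simpleReflections b) R) ∧
    (∃! Q, KazhdanLusztig.IsKLFamily (KazhdanLusztig.simpleReflections b) Q) ∧
    ∀ v w : P.weylGroup,
      KazhdanLusztig.BruhatLT (KazhdanLusztig.simpleReflections b) v w →
      KazhdanLusztig.toHalf ℚ
          (KazhdanLusztig.klPoly (KazhdanLusztig.simpleReflections b) v w) =
        KazhdanLusztig.trunc
          ((KazhdanLusztig.length (KazhdanLusztig.simpleReflections b) w : ℚ) -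
            KazhdanLusztig.length (KazhdanLusztig.simpleReflections b) v - 1)
          (∑ l ∈ KazhdanLusztig.chains (KazhdanLusztig.simpleReflections b) v w,
            (-1) ^ (l.length + 1) *
              KazhdanLusztig.nested (KazhdanLusztig.simpleReflections b) w v l) := by
  have hW := KazhdanLusztig.isCoxeterGroup_weylGroup b
  exact ⟨hW.existsUnique_isRFamily, hW.existsUnique_isKLFamily, fun v w h =>
    hW.kl_eq_trunc_chainSum hW.isKLFamily_klPoly h le_rfl (sub_le_self _ zero_le_one)⟩
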